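/- **Setting.** Let $\mathcal F=\{1,\dots,n\}$ be a set of features with domains $D_1,\dots,D_n$, let $\mathcal P\subseteq\mathcal F$ be the set of protected features, let $\mathbb F[\mathcal C]\subseteq \mathbb F=D_1\times\cdots\times D_n$ be the set of feature vectors that satisfy a given set $\mathcal C$ of constraints, and let $\kappa:\mathbb F[\mathcal C]\to\mathcal K$ be a classifier. For $x,y\in\mathbb F$ and $S\subseteq\mathcal F$ write $y_S=x_S$ if $y_i=x_i$ for all $i\in S$. Let $x\in\mathbb F[\mathcal C]$. - A *weak AXp* of the decision $\langle\kappa,x\rangle$ is a set $S\subseteq\mathcal F$ such that for all $y\in\mathbb F[\mathcal C]$, $y_S=x_S$ implies $\kappa(y)=\kappa(x)$. An *AXp* is a subset-minimal weak AXp. - $A\subseteq\mathcal F$ *subsumes* $B\subseteq\mathcal F$ if for all $y\in\mathbb F[\mathcal C]$, $y_B=x_B$ implies $y_A=x_A$; it *strictly subsumes* $B$ if moreover $B$ does not subsume $A$. - A *PI-explanation* is an AXp that is not strictly subsumed by another AXp. It is *fair* if it contains no protected feature. - The decision is *existentially fair* if it has a fair PI-explanation, and *universally fair* if all of its PI-explanations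 are fair. **Inputs.** Fix a representation scheme that assigns to each description $m\in\{0,1\}^*$ a number $n$ of features, domains $D_1,\dots,D_n\subseteq\{0,1\}^*$, a constrained feature space $\mathbb F[\mathcal C]\subseteq D_1\times\cdots\times D_n$ and a classifier $\kappa$ on $\mathbb F[\mathcal C]$ whose classes are binary words. Assume that the elements of the domains have length polynomially bounded in $|m|$, that it can be decided in polynomial time, given $m$ and a list $z$ of words, whether $z\in\mathbb F[\mathcal C]$, and that $\kappa(z)$ can be computed in polynomial time from $m$ and $z\in\mathbb F[\mathcal C]$. An input of the two problems below consists of $m$, the set $\mathcal P$ of protected features (as an $n$-bit word) and a feature vector $x\in\mathbb F[\mathcal C]$, in a standard binary encoding. **Proposition.** For every such scheme, the problem of testing whether the decision $\langle\kappa,x\rangle$ is existentially fair belongs to $\Sigma_3^{\mathrm P}$, and the problem of testing whether it is universally fair belongs to $\Pi_3^{\mathrm P}$. -/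

import Mathlib

/-! ## Explanations and fairness of a decision

`n` features, feature `i` with domain `D i`; the feature space is `∀ i, D i`. The set `C` is the set
of feature vectors that satisfy the constraints and `κ : C → K` is the classifier. -/

namespace FairDecision

section Explanations

variable {n : ℕ} {D : Fin n → Type} {K : Type}

/-- `y_S = x_S`: the vectors `y` and `x` agree on all features in `S`. -/
def AgreeOn (S : Finset (Fin n)) (y x : ∀ i, D i) : Prop :=
  ∀ i ∈ S, y i = x i

/-- `S` is a weak abductive explanation of the decision `⟨κ, x⟩`. -/
def IsWeakAXp (C : Set (∀ i, D i)) (κ : C → K) (x : C) (S : Finset (Fin n)) : Prop :=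
  ∀ y : C, AgreeOn S y.1 x.1 → κ y = κ x

/-- `S` is an abductive explanation: a subset-minimal weak abductive explanation. -/
def IsAXp (C : Set (∀ i, D i)) (κ : C → K) (x : C) (S : Finset (Fin n)) : Prop :=
  Minimal (IsWeakAXp C κ x) S

/-- `A` subsumes `B` (at `x`): `x_B` implies `x_A` in the constrained feature space. -/
def Subsumes (C : Set (∀ i, D i)) (x : C) (A B : Finset (Fin n)) : Prop :=
  ∀ y : C, AgreeOn B y.1 x.1 → AgreeOn A y.1 x.1

def StrictlySubsumes (C : Set (∀ i, D i)) (x : C) (A B : Finset (Fin n)) : Prop :=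
  Subsumes C x A B ∧ ¬ Subsumes C x B A

/-- A PI-explanation is an abductive explanation that is not strictly subsumed by another one. -/
def IsPIExplanation (C : Set (∀ i, D i)) (κ : C → K) (x : C) (S : Finset (Fin n)) : Prop :=
  IsAXp C κ x S ∧ ∀ T, IsAXp C κ x T → ¬ StrictlySubsumes C x T S

/-- An explanation is fair if it contains none of the protected features `P`. -/
def IsFair (P S : Finset (Fin n)) : Prop :=
  Disjoint S P

def ExistentiallyFair (C : Set (∀ i, D i)) (κ : C → K) (P : Finset (Fin n)) (x : C) : Prop :=
  ∃ S, IsPIExplanation C κ x S ∧ IsFair P S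

def UniversallyFair (C : Set (∀ i, D i)) (κ : C → K) (P : Finset (Fin n)) (x : C) : Prop :=
  ∀ S, IsPIExplanation C κ x S → IsFair P S

end Explanations

/-! ## Polynomial time and the third level of the polynomial hierarchy -/

/-- Binary words. -/
abbrev Word : Type := List Bool

/-- Self-delimiting code of a word: each bit `b` becomes `1b`, and `0` marks the end. -/
def delimit : Word → Word
  | [] => [false]
  | b :: w => true :: b :: delimit w

/-- Binary code of a finite sequence of words. -/
def encodeWords (ws : List Word) : Word :=
  ws.flatMap delimit

/-- `f` is computed by a (multi-stack) Turing machine in time polynomial in the length of the code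
of the argument. -/
def PolyTimeComputable {α β : Type} (ea : α → Word) (eb : β → Word) (f : α → β) : Prop :=
  Nonempty (Turing.TM2ComputableInPolyTime ea eb f)

open scoped Classical in
/-- The predicate `p` is decided in polynomial time, with the one-bit answer as output. -/
noncomputable def PolyTimeDecidable {α : Type} (ea : α → Word) (p : α → Prop) : Prop :=
  PolyTimeComputable ea (fun b : Bool => [b]) (fun a => decide (p a))

/-- The class `Σ₃ᴾ`: `∃ ∀ ∃` over words of polynomially bounded length, in front of a
polynomial-time decidable relation. -/
def InSigma3P (L : Set Word) : Prop :=
  ∃ (q : Polynomial ℕ) (R : Word × Word × Word × Word → Prop),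
    PolyTimeDecidable (fun t => encodeWords [t.1, t.2.1, t.2.2.1, t.2.2.2]) R ∧
    ∀ w : Word, w ∈ L ↔
      ∃ u₁ : Word, u₁.length ≤ q.eval w.length ∧
        ∀ u₂ : Word, u₂.length ≤ q.eval w.length →
          ∃ u₃ : Word, u₃.length ≤ q.eval w.length ∧ R (w, u₁, u₂, u₃)

/-- The class `Π₃ᴾ = coΣ₃ᴾ`. -/
def InPi3P (L : Set Word) : Prop :=
  InSigma3P Lᶜ

/-! ## Classifiers as inputs -/

/-- A representation scheme for classifiers on constrained feature spaces: it assigns to each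
description `m` a number of features, their domains (feature values are written as words), the set
of feature vectors that satisfy the constraints, and a classifier on this set (classes are written
as words). A word that describes nothing may be given an empty constrained feature space. -/
structure ClassifierScheme where
  numFeatures : Word → ℕ
  dom : ∀ m, Fin (numFeatures m) → Set Word
  feasible : ∀ m, Set (∀ i, dom m i)
  classify : ∀ m, feasible m → Word

namespace ClassifierScheme

variable (𝒮 : ClassifierScheme)

/-- A feature vector as the list of its values. -/
def values {m : Word} (z : ∀ i, 𝒮.dom m i) : List Word :=
  List.ofFn fun i => (z i : Word)

/-- The standing complexity assumptions: values of features have length polynomial in the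
description, membership in the constrained feature space is decidable in polynomial time, and the
class of a feature vector in the constrained feature space is computable in polynomial time. -/
structure IsPolyTime : Prop where
  dom_bounded : ∃ p : Polynomial ℕ, ∀ m i, ∀ v ∈ 𝒮.dom m i, v.length ≤ p.eval m.length
  feasible_decidable :
    PolyTimeDecidable (fun t : Word × List Word => encodeWords (t.1 :: t.2))
      (fun t => ∃ z ∈ 𝒮.feasible t.1, 𝒮.values z = t.2)
  classify_computable :
    PolyTimeComputable (fun t : (Σ m, 𝒮.feasible m) => encodeWords (t.1 :: 𝒮.values t.2.1))
      (id : Word → Word) (fun t => 𝒮.classify t.1 t.2)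

/-- An input of the fairness problems: a described classifier, the set of protected features, and
a feature vector in the constrained feature space, whose decision is to be tested. -/
structure Decision where
  descr : Word
  protectedSet : Finset (Fin (𝒮.numFeatures descr))
  point : 𝒮.feasible descr

/-- The code of an input: the description, the characteristic word of the set of protected
features, and the values of the feature vector. -/
def Decision.encode {𝒮 : ClassifierScheme} (d : 𝒮.Decision) : Word :=
  encodeWords
    (d.descr :: (List.ofFn fun i => decide (i ∈ d.protectedSet)) :: 𝒮.values d.point.1)

/-- The decision problem "is this decision existentially fair?" -/
def existentialFairness : Set Word :=
  {w | ∃ d : 𝒮.Decision, d.encode = w ∧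
    ExistentiallyFair (𝒮.feasible d.descr) (𝒮.classify d.descr) d.protectedSet d.point}

/-- The decision problem "is this decision universally fair?" -/
def universalFairness : Set Word :=
  {w | ∃ d : 𝒮.Decision, d.encode = w ∧
    UniversallyFair (𝒮.feasible d.descr) (𝒮.classify d.descr) d.protectedSet d.point}

end ClassifierScheme

end FairDecision

/-! The core is `isPIExplanation_iff`, which describes PI-explanations by a condition of the form `∀
T y, ∃ z` over sets of features and feasible vectors. Taken literally, the definition ranges over
all AXps `T`, and the minimality of `T` would add a further alternation. It is enough to range over
weak AXps: if a weak AXp `T` subsumes `S`, then every AXp `T' ⊆ T` subsumes `S` as well, and if `S`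
subsumes `T'`, then it subsumes `T`.

So `S` is a PI-explanation iff it is a weak AXp and each `T` satisfies one of the following: some
`z` refutes that `T` is a weak AXp; some `z` refutes that `T` subsumes `S`; or `S` subsumes `T` and
`T` is not a proper subset of `S`. The clause on proper subsets encodes the minimality of `S`,
because a subset of `S` always subsumes `S`. What must hold for all vectors is checked at the single
vector `y`, which is chosen together with `T`; what must fail somewhere is witnessed by `z`.

Guessing `S` and testing it for protected features gives `∃ S, ∀ (T, y), ∃ z` for existential
fairness. A word outside universal fairness is either not the code of an input or has a
PI-explanation that is not fair, and this has the same quantifier prefix. Witnesses have polynomial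
length because the values of features do and because the number of features is at most the length of
the input.

What remains is that the matrix is decidable in polynomial time by a multi-stack machine. For this,
a small language of register programs that call given machines (`Prog`, `RegProg`) is compiled to
one machine by `polyTimeComputable_of_runs`. It shows that polynomial-time functions are closed
under composition, pairing, case distinction on a promise (`PolyTime.dite`) and folding along a word
with polynomially bounded results (`PolyTime.foldl`). All tests are built from these. -/

namespace FairDecision

open Turing Function

/-! ### Time-bounded runs of a transition function -/

section Within

variable {C C' : Type*}

/-- From `a` the transition function `f` leads to `b` in at most `t` steps. -/
def Within (f : C → Option C) (t : ℕ) (a b : C) : Prop :=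
  ∃ n ≤ t, (flip bind f)^[n] (some a) = some b

theorem Within.refl (f : C → Option C) (a : C) : Within f 0 a a :=
  ⟨0, le_rfl, rfl⟩

theorem Within.mono {f : C → Option C} {t t' : ℕ} {a b : C} (h : Within f t a b) (ht : t ≤ t') :
    Within f t' a b :=
  let ⟨n, hn, e⟩ := h
  ⟨n, hn.trans ht, e⟩

theorem Within.trans {f : C → Option C} {t t' : ℕ} {a b c : C} (h : Within f t a b)
    (h' : Within f t' b c) : Within f (t + t') a c := by
  obtain ⟨n, hn, e⟩ := h
  obtain ⟨n', hn', e'⟩ := h'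
  refine ⟨n' + n, by omega, ?_⟩
  rw [iterate_add_apply, e, e']

theorem Within.single {f : C → Option C} {a b : C} (h : f a = some b) : Within f 1 a b :=
  ⟨1, le_rfl, h⟩

theorem flip_bind_iterate_none (f : C → Option C) (n : ℕ) :
    (flip bind f)^[n] none = none := by
  induction n with
  | zero => rfl
  | succ n ih => rw [iterate_succ_apply]; exact ih

/-- Induction on the run with its end `b` fixed. As `t` only bounds the number of steps, the base
case is needed for every `t`. -/
theorem Within.induction {f : C → Option C} {motive : ℕ → C → Prop} {t : ℕ} {a b : C}
    (h : Within f t a b) (refl : ∀ t, motive t b)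
    (step : ∀ t a a', f a = some a' → motive t a' → motive (t + 1) a) : motive t a := by
  obtain ⟨n, hn, e⟩ := h
  induction n generalizing a t with
  | zero =>
    obtain rfl : a = b := by simpa using e
    exact refl t
  | succ n ih =>
    rw [iterate_succ_apply] at e
    change (flip bind f)^[n] (f a) = some b at e
    cases ha : f a with
    | none =>
      rw [ha, flip_bind_iterate_none] at e
      simp at e
    | some a' =>
      obtain ⟨t, rfl⟩ : ∃ s, t = s + 1 := ⟨t - 1, by omega⟩
      exact step t a a' ha (ih (by omega) (by rw [← ha]; exact e))

theorem Within.map {f : C → Option C} {g : C' → Option C'} (φ : C → C')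
    (hφ : ∀ a b, f a = some b → g (φ a) = some (φ b)) {t : ℕ} {a b : C} (h : Within f t a b) :
    Within g t (φ a) (φ b) := by
  refine h.induction (motive := fun t a => Within g t (φ a) (φ b))
    (fun t => (Within.refl _ _).mono (Nat.zero_le t)) fun t a a' ha ih => ?_
  rw [add_comm]
  exact (Within.single (hφ _ _ ha)).trans ih

end Within

/-! ### Transport of runs between stack machines, and growth of the stacks -/

section Stmt

variable {K : Type} {Γ : K → Type} {Λ Λ' σ : Type}

/-- Rename the labels of a statement and replace `halt` by a jump to `e` (if there is one). -/
def relabel (f : Λ → Λ') (e : Option Λ') : TM2.Stmt Γ Λ σ → TM2.Stmt Γ Λ' σ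
  | .push k g q => .push k g (relabel f e q)
  | .peek k g q => .peek k g (relabel f e q)
  | .pop k g q => .pop k g (relabel f e q)
  | .load g q => .load g (relabel f e q)
  | .branch g q₁ q₂ => .branch g (relabel f e q₁) (relabel f e q₂)
  | .goto l => .goto fun v => f (l v)
  | .halt => match e with
    | some l => .goto fun _ => l
    | none => .halt

/-- A halted configuration is sent to the exit label `e`; this is what lets one run be continued by
another. -/
def relabelCfg (f : Λ → Λ') (e : Option Λ') (c : TM2.Cfg Γ Λ σ) : TM2.Cfg Γ Λ' σ :=
  ⟨c.l.elim e fun l => some (f l), c.var, c.stk⟩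

variable [DecidableEq K]

theorem stepAux_relabel (f : Λ → Λ') (e : Option Λ') (q : TM2.Stmt Γ Λ σ) (v : σ)
    (S : ∀ k, List (Γ k)) :
    TM2.stepAux (relabel f e q) v S = relabelCfg f e (TM2.stepAux q v S) := by
  induction q generalizing v S with
  | branch g q₁ q₂ ih₁ ih₂ => cases h : g v <;> simp [relabel, h, ih₁, ih₂]
  | goto l => rfl
  | halt => cases e <;> rfl
  | _ => simp_all [relabel]

theorem Within.relabel {M : Λ → TM2.Stmt Γ Λ σ} {N : Λ' → TM2.Stmt Γ Λ' σ} {f : Λ → Λ'}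
    {e : Option Λ'} (hN : ∀ l, N (f l) = FairDecision.relabel f e (M l)) {t : ℕ}
    {a b : TM2.Cfg Γ Λ σ} (h : Within (TM2.step M) t a b) :
    Within (TM2.step N) t (relabelCfg f e a) (relabelCfg f e b) := by
  refine h.map _ fun a b hab => ?_
  obtain ⟨_ | l, v, S⟩ := a
  · simp at hab
  · simp only [TM2.step, Option.some.injEq] at hab
    simp [relabelCfg, hN, stepAux_relabel, ← hab]

/-- Run a statement on some of the stacks and on a part of the internal state of a machine. -/
def inject {K₀ : Type} (ι : K₀ → K) {σ₀ : Type} (get : σ → σ₀) (put : σ₀ → σ) :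
    TM2.Stmt (fun k => Γ (ι k)) Λ σ₀ → TM2.Stmt Γ Λ σ
  | .push k g q => .push (ι k) (fun v => g (get v)) (inject ι get put q)
  | .peek k g q => .peek (ι k) (fun v o => put (g (get v) o)) (inject ι get put q)
  | .pop k g q => .pop (ι k) (fun v o => put (g (get v) o)) (inject ι get put q)
  | .load g q => .load (fun v => put (g (get v))) (inject ι get put q)
  | .branch g q₁ q₂ => .branch (fun v => g (get v)) (inject ι get put q₁) (inject ι get put q₂)
  | .goto l => .goto fun v => l (get v)
  | .halt => .halt

variable {K₀ : Type} [DecidableEq K₀] {ι : K₀ → K} {σ₀ : Type} {get : σ → σ₀} {put : σ₀ → σ}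
  {wr : (∀ k, List (Γ (ι k))) → ∀ k, List (Γ k)}

/-- `wr` places the stacks of the small machine into fixed surroundings and `put` does so for its
state. The hypotheses say that reading and updating through `ι` and `get` do not see the
surroundings. -/
theorem stepAux_inject (hget : ∀ v, get (put v) = v) (hwr : ∀ T k, wr T (ι k) = T k)
    (hup : ∀ T k l, update (wr T) (ι k) l = wr (update T k l))
    (q : TM2.Stmt (fun k => Γ (ι k)) Λ σ₀) (v : σ₀) (T : ∀ k, List (Γ (ι k))) :
    TM2.stepAux (inject ι get put q) (put v) (wr T) =
      ⟨(TM2.stepAux q v T).l, put (TM2.stepAux q v T).var, wr (TM2.stepAux q v T).stk⟩ := by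
  induction q generalizing v T with
  | branch g q₁ q₂ ih₁ ih₂ => cases h : g v <;> simp [inject, hget, h, ih₁, ih₂]
  | _ => simp_all [inject]

theorem Within.inject (hget : ∀ v, get (put v) = v) (hwr : ∀ T k, wr T (ι k) = T k)
    (hup : ∀ T k l, update (wr T) (ι k) l = wr (update T k l))
    {M : Λ → TM2.Stmt (fun k => Γ (ι k)) Λ σ₀} {t : ℕ}
    {a b : TM2.Cfg (fun k => Γ (ι k)) Λ σ₀} (h : Within (TM2.step M) t a b) :
    Within (TM2.step fun l => FairDecision.inject (Γ := Γ) ι get put (M l)) t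
      ⟨a.l, put a.var, wr a.stk⟩ ⟨b.l, put b.var, wr b.stk⟩ := by
  refine h.map (fun c => (⟨c.l, put c.var, wr c.stk⟩ : TM2.Cfg Γ Λ σ)) fun a b hab => ?_
  obtain ⟨_ | l, v, S⟩ := a
  · simp at hab
  · simp only [TM2.step, Option.some.injEq] at hab
    simp only [TM2.step, stepAux_inject hget hwr hup, hab]

/-- The number of `push` instructions in a statement. -/
def pushCount : TM2.Stmt Γ Λ σ → ℕ
  | .push _ _ q => pushCount q + 1
  | .peek _ _ q => pushCount q
  | .pop _ _ q => pushCount q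
  | .load _ q => pushCount q
  | .branch _ q₁ q₂ => pushCount q₁ + pushCount q₂
  | .goto _ => 0
  | .halt => 0

/-- Only `push` lengthens a stack. Both alternatives of a `branch` are counted, which overestimates
harmlessly. -/
theorem length_stepAux_le (q : TM2.Stmt Γ Λ σ) (v : σ) (S : ∀ k, List (Γ k)) (k : K) :
    ((TM2.stepAux q v S).stk k).length ≤ (S k).length + pushCount q := by
  induction q generalizing v S with
  | push k' g q ih =>
    refine (ih _ _).trans ?_
    rcases eq_or_ne k k' with rfl | h
    · simp only [update_self, List.length_cons, pushCount]; omega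
    · simp only [update_of_ne h, pushCount]; omega
  | pop k' g q ih =>
    refine (ih _ _).trans ?_
    rcases eq_or_ne k k' with rfl | h
    · simp [pushCount]
    · simp [pushCount, h]
  | branch g q₁ q₂ ih₁ ih₂ =>
    have h₁ := ih₁ v S
    have h₂ := ih₂ v S
    cases h : g v <;> simp only [TM2.stepAux, h, cond_true, cond_false, pushCount] <;> omega
  | peek _ _ _ ih => exact ih _ _
  | load _ _ ih => exact ih _ _
  | goto l => simp [pushCount]
  | halt => simp [pushCount]

/-- A step executes the statement of one label, so the sum over all labels bounds its pushes. This
turns a time bound into a bound for the length of the output. -/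
theorem Within.length_le [Fintype Λ] {M : Λ → TM2.Stmt Γ Λ σ} {t : ℕ} {a b : TM2.Cfg Γ Λ σ}
    (h : Within (TM2.step M) t a b) (k : K) :
    (b.stk k).length ≤ (a.stk k).length + t * ∑ l, pushCount (M l) := by
  refine h.induction (motive := fun t a =>
    (b.stk k).length ≤ (a.stk k).length + t * ∑ l, pushCount (M l))
    (fun t => Nat.le_add_right _ _) fun t a a' ha ih => ?_
  obtain ⟨_ | l, v, S⟩ := a
  · simp at ha
  · simp only [TM2.step, Option.some.injEq] at ha
    have h₁ := length_stepAux_le (M l) v S k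
    have h₂ : pushCount (M l) ≤ ∑ l, pushCount (M l) :=
      Finset.single_le_sum (f := fun l => pushCount (M l)) (fun _ _ => Nat.zero_le _)
        (Finset.mem_univ l)
    rw [ha] at h₁
    rw [add_mul, one_mul]
    change _ ≤ (S k).length + _
    omega

end Stmt

/-! ### Structured programs for stack machines -/

/-- A program that works on the stacks `Γ` with internal states `Option Bool × τ`. -/
structure Prog {K : Type} (Γ : K → Type) (τ : Type) where
  Λ : Type
  [fintypeΛ : Fintype Λ]
  main : Λ
  code : Λ → TM2.Stmt Γ Λ (Option Bool × τ)

namespace Prog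

attribute [instance] Prog.fintypeΛ

variable {K : Type} {Γ : K → Type} {τ : Type}

section

variable [DecidableEq K] [Inhabited τ]

/-- The program, started in the default internal state, changes the stacks from `S` to `S'` in at
most `t` steps and halts in the default internal state. -/
def Runs (P : Prog Γ τ) (S S' : ∀ k, List (Γ k)) (t : ℕ) : Prop :=
  Within (TM2.step P.code) t ⟨some P.main, default, S⟩ ⟨none, default, S'⟩

theorem Runs.mono {P : Prog Γ τ} {S S' : ∀ k, List (Γ k)} {t t' : ℕ} (h : P.Runs S S' t)
    (ht : t ≤ t') : P.Runs S S' t' :=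
  Within.mono h ht

end

/-- Do nothing. -/
def skip : Prog Γ τ where
  Λ := Unit
  main := ()
  code _ := .halt

/-- Push a symbol. -/
def push (k : K) (g : Γ k) : Prog Γ τ where
  Λ := Unit
  main := ()
  code _ := .push k (fun _ => g) .halt

def seq (P Q : Prog Γ τ) : Prog Γ τ where
  Λ := P.Λ ⊕ Q.Λ
  main := .inl P.main
  code
    | .inl l => relabel .inl (some (.inr Q.main)) (P.code l)
    | .inr l => relabel .inr none (Q.code l)

/-- Pop a symbol from the stack `k` and continue according to the bit that `d` assigns to it. -/
def popStmt {Λ : Type} (k : K) (d : Γ k → Bool) (n : TM2.Stmt Γ Λ (Option Bool × τ))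
    (lf lt : Λ) : TM2.Stmt Γ Λ (Option Bool × τ) :=
  -- The `Option Bool` component holds the popped bit only during this statement. It is reset before
  -- each jump, and it is `none` anyway if the stack was empty, so every subprogram starts in the
  -- default state.
  .pop k (fun v o => (o.map d, v.2)) <| .branch (fun v => v.1.isNone) n <|
    .branch (fun v => v.1 == some true) (.load (fun v => (none, v.2)) (.goto fun _ => lt))
      (.load (fun v => (none, v.2)) (.goto fun _ => lf))

/-- Pop a symbol from the stack `k` and run one of three programs. -/
def case (k : K) (d : Γ k → Bool) (Pn Pf Pt : Prog Γ τ) : Prog Γ τ where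
  Λ := Option (Pn.Λ ⊕ Pf.Λ ⊕ Pt.Λ)
  main := none
  code
    | none => popStmt k d (.goto fun _ => some (.inl Pn.main)) (some (.inr (.inl Pf.main)))
        (some (.inr (.inr Pt.main)))
    | some (.inl l) => relabel (fun l => some (.inl l)) none (Pn.code l)
    | some (.inr (.inl l)) => relabel (fun l => some (.inr (.inl l))) none (Pf.code l)
    | some (.inr (.inr l)) => relabel (fun l => some (.inr (.inr l))) none (Pt.code l)

/-- As long as the stack `k` is not empty, pop a symbol and run one of two programs. -/
def loop (k : K) (d : Γ k → Bool) (Pf Pt : Prog Γ τ) : Prog Γ τ where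
  Λ := Option (Pf.Λ ⊕ Pt.Λ)
  main := none
  code
    | none => popStmt k d .halt (some (.inl Pf.main)) (some (.inr Pt.main))
    | some (.inl l) => relabel (fun l => some (.inl l)) (some none) (Pf.code l)
    | some (.inr l) => relabel (fun l => some (.inr l)) (some none) (Pt.code l)

variable [DecidableEq K] [Inhabited τ] {S S₁ S₂ : ∀ k, List (Γ k)} {t t' : ℕ}

theorem runs_skip (S : ∀ k, List (Γ k)) : (skip : Prog Γ τ).Runs S S 1 :=
  Within.single rfl

theorem runs_push (k : K) (g : Γ k) (S : ∀ k, List (Γ k)) :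
    (push k g : Prog Γ τ).Runs S (update S k (g :: S k)) 1 :=
  Within.single rfl

theorem Runs.seq {P Q : Prog Γ τ} (hP : P.Runs S S₁ t) (hQ : Q.Runs S₁ S₂ t') :
    (P.seq Q).Runs S S₂ (t + t') :=
  (Within.relabel (N := (P.seq Q).code) (f := Sum.inl) (fun _ => rfl) hP).trans
    (Within.relabel (N := (P.seq Q).code) (f := Sum.inr) (e := none) (fun _ => rfl) hQ)

section Pop

variable {Λ : Type} {k : K} (d : Γ k → Bool) (n : TM2.Stmt Γ Λ (Option Bool × τ)) (lf lt : Λ)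

theorem stepAux_popStmt_nil (h : S k = []) :
    TM2.stepAux (popStmt k d n lf lt) default S = TM2.stepAux n default S := by
  have : update S k [] = S := by rw [← h, update_eq_self]
  simp [popStmt, h, this]
  rfl

theorem stepAux_popStmt_cons {g : Γ k} {l : List (Γ k)} (h : S k = g :: l) :
    TM2.stepAux (popStmt k d n lf lt) default S =
      ⟨some (bif d g then lt else lf), default, update S k l⟩ := by
  cases hg : d g <;> simp [popStmt, h, hg] <;> rfl

end Pop

theorem Runs.case_nil {k : K} {d : Γ k → Bool} {Pn Pf Pt : Prog Γ τ} (h : S k = [])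
    (hP : Pn.Runs S S₁ t) : (case k d Pn Pf Pt).Runs S S₁ (1 + t) := by
  refine (Within.single ?_).trans (Within.relabel (N := (case k d Pn Pf Pt).code)
    (f := fun l => some (.inl l)) (e := none) (fun _ => rfl) hP)
  exact congrArg some (stepAux_popStmt_nil d _ _ _ h)

theorem Runs.case_cons {k : K} {d : Γ k → Bool} {Pn Pf Pt : Prog Γ τ} {g : Γ k}
    {l : List (Γ k)} (h : S k = g :: l)
    (hP : (bif d g then Pt else Pf).Runs (update S k l) S₁ t) :
    (case k d Pn Pf Pt).Runs S S₁ (1 + t) := by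
  have e : TM2.step (case k d Pn Pf Pt).code ⟨some none, default, S⟩ = some _ :=
    congrArg some (stepAux_popStmt_cons d _ _ _ h)
  cases hg : d g <;> rw [hg] at e hP
  · exact (Within.single e).trans (Within.relabel (N := (case k d Pn Pf Pt).code)
      (f := fun l => some (.inr (.inl l))) (e := none) (fun _ => rfl) hP)
  · exact (Within.single e).trans (Within.relabel (N := (case k d Pn Pf Pt).code)
      (f := fun l => some (.inr (.inr l))) (e := none) (fun _ => rfl) hP)

theorem Runs.loop_nil {k : K} {d : Γ k → Bool} {Pf Pt : Prog Γ τ} (h : S k = []) :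
    (loop k d Pf Pt).Runs S S 1 :=
  Within.single (congrArg some (stepAux_popStmt_nil d _ _ _ h))

theorem Runs.loop_cons {k : K} {d : Γ k → Bool} {Pf Pt : Prog Γ τ} {g : Γ k}
    {l : List (Γ k)} (h : S k = g :: l)
    (hP : (bif d g then Pt else Pf).Runs (update S k l) S₁ t)
    (hL : (loop k d Pf Pt).Runs S₁ S₂ t') :
    (loop k d Pf Pt).Runs S S₂ (1 + t + t') := by
  have e : TM2.step (loop k d Pf Pt).code ⟨some none, default, S⟩ = some _ :=
    congrArg some (stepAux_popStmt_cons d _ _ _ h)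
  refine Within.trans ?_ hL
  cases hg : d g <;> rw [hg] at e hP
  · exact (Within.single e).trans (Within.relabel (N := (loop k d Pf Pt).code)
      (f := fun l => some (.inl l)) (e := some none) (fun _ => rfl) hP)
  · exact (Within.single e).trans (Within.relabel (N := (loop k d Pf Pt).code)
      (f := fun l => some (.inr l)) (e := some none) (fun _ => rfl) hP)

end Prog

end FairDecision

namespace FairDecision

open Turing Function

/-! ### Programs with four registers that call given machines -/

/-- The names of the registers. -/
inductive Reg
  | a | b | c | d
  deriving DecidableEq

instance : Fintype Reg :=
  ⟨{.a, .b, .c, .d}, fun r => by cases r <;> simp⟩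

/-- The contents of the four registers. -/
def regs (a b c d : Word) : Reg → Word
  | .a => a
  | .b => b
  | .c => c
  | .d => d

section

variable (a b c d x : Word)

@[simp] theorem regs_a : regs a b c d .a = a := rfl
@[simp] theorem regs_b : regs a b c d .b = b := rfl
@[simp] theorem regs_c : regs a b c d .c = c := rfl
@[simp] theorem regs_d : regs a b c d .d = d := rfl

@[simp] theorem update_regs_a : update (regs a b c d) .a x = regs x b c d := by
  funext r; cases r <;> simp [regs]
@[simp] theorem update_regs_b : update (regs a b c d) .b x = regs a x c d := by
  funext r; cases r <;> simp [regs]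
@[simp] theorem update_regs_c : update (regs a b c d) .c x = regs a b x d := by
  funext r; cases r <;> simp [regs]
@[simp] theorem update_regs_d : update (regs a b c d) .d x = regs a b c x := by
  funext r; cases r <;> simp [regs]

end

variable {I : Type} (A : I → TM2ComputableAux Bool Bool)

/-- The stacks: the registers and the stacks of the machines that may be called. -/
abbrev Stack : Type := Reg ⊕ Σ i, (A i).tm.K

/-- The stack alphabets. -/
abbrev Alph : Stack A → Type
  | .inl _ => Bool
  | .inr p => (A p.1).tm.Γ p.2

/-- The internal states of the machines that may be called. -/
abbrev CallState : Type := ∀ i, (A i).tm.σ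

abbrev RegProg : Type 1 := Prog (Alph A) (CallState A)

variable {A}

/-- The stack contents with registers `s` and machine stacks `T`. -/
def contents (s : Reg → Word) (T : ∀ p : Σ i, (A i).tm.K, List ((A p.1).tm.Γ p.2)) :
    ∀ k, List (Alph A k)
  | .inl r => s r
  | .inr p => T p

/-- The stack contents with registers `s` and empty machine stacks. -/
def idle (s : Reg → Word) : ∀ k, List (Alph A k) := contents s fun _ => []

@[simp] theorem idle_inl (s : Reg → Word) (r : Reg) :
    (idle s : ∀ k, List (Alph A k)) (.inl r) = s r :=
  rfl

variable [DecidableEq I]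

theorem update_contents_inl (s : Reg → Word) (T : ∀ p : Σ i, (A i).tm.K, List ((A p.1).tm.Γ p.2))
    (r : Reg) (l : Word) :
    update (contents s T) (.inl r) l = contents (update s r l) T := by
  funext k
  rcases k with r' | p
  · rcases eq_or_ne r' r with rfl | h
    · simp [contents]
    · simp [contents, h]
  · simp [contents]

theorem update_contents_inr (s : Reg → Word) (T : ∀ p : Σ i, (A i).tm.K, List ((A p.1).tm.Γ p.2))
    (p : Σ i, (A i).tm.K) (l : List ((A p.1).tm.Γ p.2)) :
    update (contents s T) (.inr p) l = contents s (update T p l) := by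
  funext k
  rcases k with r | p'
  · simp [contents]
  · rcases eq_or_ne p' p with rfl | h
    · simp [contents]
    · simp [contents, h]

@[simp] theorem update_idle (s : Reg → Word) (r : Reg) (l : Word) :
    update (idle s : ∀ k, List (Alph A k)) (.inl r) l = idle (update s r l) :=
  update_contents_inl ..

/-- Stack contents of the machine `i`, the stacks of the other machines being empty. -/
def onMachine (i : I) (T : ∀ k, List ((A i).tm.Γ k)) (p : Σ i, (A i).tm.K) :
    List ((A p.1).tm.Γ p.2) :=
  update (β := fun i => ∀ k, List ((A i).tm.Γ k)) (fun _ _ => []) i T p.1 p.2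

theorem onMachine_self (i : I) (T : ∀ k, List ((A i).tm.Γ k)) (k : (A i).tm.K) :
    onMachine i T ⟨i, k⟩ = T k := by
  simp [onMachine]

theorem update_onMachine (i : I) (T : ∀ k, List ((A i).tm.Γ k)) (k : (A i).tm.K)
    (l : List ((A i).tm.Γ k)) :
    update (onMachine i T) ⟨i, k⟩ l = onMachine i (update T k l) := by
  funext ⟨j, k'⟩
  rcases eq_or_ne j i with rfl | h
  · rcases eq_or_ne k' k with rfl | h
    · simp [onMachine]
    · rw [update_of_ne (by simpa using h), onMachine_self, onMachine_self, update_of_ne h]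
  · rw [update_of_ne (by simp [h])]
    simp [onMachine, h]

theorem onMachine_empty (i : I) :
    (onMachine i fun _ => [] : ∀ p : Σ i, (A i).tm.K, List ((A p.1).tm.Γ p.2)) =
      fun _ => [] := by
  funext ⟨j, k⟩
  rcases eq_or_ne j i with rfl | h
  · rw [onMachine_self]
  · simp [onMachine, h]

theorem initList_stk (tm : FinTM2) (l : List (tm.Γ tm.k₀)) :
    (initList tm l).stk = update (fun _ => []) tm.k₀ l := by
  funext k
  by_cases h : k = tm.k₀
  · subst h; simp [initList]
  · simp [initList, h]

theorem haltList_stk (tm : FinTM2) (l : List (tm.Γ tm.k₁)) :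
    (haltList tm l).stk = update (fun _ => []) tm.k₁ l := by
  funext k
  by_cases h : k = tm.k₁
  · subst h; simp [haltList]
  · simp [haltList, h]

theorem TM2OutputsInTime.within {tm : FinTM2} {l : List (tm.Γ tm.k₀)} {l' : List (tm.Γ tm.k₁)}
    {t : ℕ} (h : TM2OutputsInTime tm l (some l') t) :
    Within (TM2.step tm.m) t (initList tm l) (haltList tm l') :=
  ⟨h.steps, h.steps_le_m, h.evals_in_steps⟩

namespace Prog

instance : Inhabited (CallState A) := ⟨fun i => (A i).tm.initialState⟩

section Move

variable {K : Type} {Γ : K → Type} {τ : Type}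

/-- Move the contents of the stack `k` to the stack `k'`, in reverse order. -/
def move (k : K) (d : Γ k → Bool) (k' : K) (g : Bool → Γ k') : Prog Γ τ :=
  loop k d (push k' (g false)) (push k' (g true))

theorem runs_move [DecidableEq K] [Inhabited τ] {k k' : K} (hk : k ≠ k') (d : Γ k → Bool)
    (g : Bool → Γ k') (S : ∀ k, List (Γ k)) :
    (move k d k' g : Prog Γ τ).Runs S
      (update (update S k []) k' (((S k).map fun x => g (d x)).reverse ++ S k'))
      (2 * (S k).length + 1) := by
  generalize hl : S k = l
  induction l generalizing S with
  | nil =>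
    have : update (update S k []) k' (S k') = S := by
      rw [← hl, update_eq_self, update_eq_self]
    simpa [this, move] using Runs.loop_nil (Pf := push k' (g false)) (Pt := push k' (g true)) hl
  | cons x l ih =>
    have h₁ : (bif d x then push k' (g true) else push k' (g false) : Prog Γ τ).Runs
        (update S k l) (update (update S k l) k' (g (d x) :: S k')) 1 := by
      have := runs_push (τ := τ) k' (g (d x)) (update S k l)
      rw [update_of_ne hk.symm] at this
      cases h : d x <;> simpa [h] using this
    have h₂ := ih (update (update S k l) k' (g (d x) :: S k')) (by simp [hk])
    have e : update (update (update (update S k l) k' (g (d x) :: S k')) k []) k'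
        ((l.map fun x => g (d x)).reverse ++
          (update (update S k l) k' (g (d x) :: S k')) k') =
        update (update S k []) k' (((x :: l).map fun x => g (d x)).reverse ++ S k') := by
      rw [update_comm hk.symm, update_idem, update_idem]
      simp
    rw [e] at h₂
    refine (Runs.loop_cons hl h₁ h₂).mono ?_
    simp only [List.length_cons]; omega

end Move

/-- Run the machine `i` on its own stacks. -/
def exec (i : I) : RegProg A where
  Λ := (A i).tm.Λ
  fintypeΛ := (A i).tm.ΛFin
  main := (A i).tm.main
  code l := inject (Γ := Alph A) (fun k => .inr ⟨i, k⟩) (fun v => v.2 i)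
    (fun x => (none, update default i x)) ((A i).tm.m l)

/-- `initList` and `haltList` both carry the initial state of the machine, so a call begins and ends
in the default internal state and leaves nothing but its output on the machine stacks. Hence the
same machine can be called repeatedly. -/
theorem runs_exec {i : I} {l : List ((A i).tm.Γ (A i).tm.k₀)}
    {l' : List ((A i).tm.Γ (A i).tm.k₁)} {t : ℕ}
    (h : Within (TM2.step (A i).tm.m) t (initList (A i).tm l) (haltList (A i).tm l'))
    (s : Reg → Word) :
    (exec i : RegProg A).Runs (contents s (update (fun _ => []) ⟨i, (A i).tm.k₀⟩ l))
      (contents s (update (fun _ => []) ⟨i, (A i).tm.k₁⟩ l')) t := by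
  have h' := Within.inject (Γ := Alph A) (ι := fun k => .inr ⟨i, k⟩)
    (get := fun v : Option Bool × CallState A => v.2 i)
    (put := fun x => (none, update default i x)) (wr := fun T => contents s (onMachine i T))
    (fun v => by simp) (fun T k => onMachine_self i T k)
    (fun T k l => by rw [update_contents_inr, ← update_onMachine]) h
  have e : ∀ k (l : List ((A i).tm.Γ k)), onMachine i (update (fun _ => []) k l) =
      update (fun _ => [] : ∀ p : Σ i, (A i).tm.K, List ((A p.1).tm.Γ p.2)) ⟨i, k⟩ l := fun k l => by
    rw [← update_onMachine, onMachine_empty]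
  have hd : ((none, update default i (A i).tm.initialState) : Option Bool × CallState A) =
      default := by
    change (none, update (default : CallState A) i ((default : CallState A) i)) = _
    rw [update_eq_self]; rfl
  rw [initList_stk, haltList_stk] at h'
  rw [e, e] at h'
  change Within _ _
    (TM2.Cfg.mk _ (none, (update default i (A i).tm.initialState : CallState A)) _)
    (TM2.Cfg.mk _ (none, (update default i (A i).tm.initialState : CallState A)) _) at h'
  rw [hd] at h'
  exact h'

/-- Move a register to another one, in reverse order. -/
def flow (r r' : Reg) : RegProg A := move (.inl r) id (.inl r') id

theorem runs_flow {r r' : Reg} (h : r ≠ r') (s : Reg → Word) :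
    (flow r r' : RegProg A).Runs (idle s)
      (idle (update (update s r []) r' ((s r).reverse ++ s r'))) (2 * (s r).length + 1) := by
  have := runs_move (Γ := Alph A) (τ := CallState A) (k := .inl r) (k' := .inl r') (by simpa using h)
    id id (idle s)
  simpa [flow] using this

/-- Replace the contents of the register `r` by the output of the machine `i`. -/
def call (i : I) (r : Reg) : RegProg A :=
  (flow r .c).seq <| (move (.inl .c) id (.inr ⟨i, (A i).tm.k₀⟩) (A i).inputAlphabet.symm).seq <|
    (exec i).seq <| (move (.inr ⟨i, (A i).tm.k₁⟩) (A i).outputAlphabet (.inl .c) id).seq <|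
      flow .c r

/-- Each move reverses a word, so input and output both pass through register `c`, which must be
empty, and are reversed twice. The four moves cost two steps per symbol and one step each for the
final test. -/
theorem runs_call {i : I} {w w' : Word} {t : ℕ}
    (h : Within (TM2.step (A i).tm.m) t (initList (A i).tm (w.map (A i).inputAlphabet.invFun))
      (haltList (A i).tm (w'.map (A i).outputAlphabet.invFun)))
    {r : Reg} (hr : r ≠ .c) (s : Reg → Word) (hw : s r = w) (hc : s .c = []) :
    (call i r : RegProg A).Runs (idle s) (idle (update s r w'))
      (t + 4 * w.length + 4 * w'.length + 4) := by
  have hs : ∀ x y : Word, update (update (update s r x) .c y) .c [] = update s r x := fun x y => by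
    rw [update_idem]; exact update_eq_self_iff.2 (by rw [update_of_ne hr.symm, hc])
  have h₁ := runs_flow (A := A) hr s
  rw [hw, hc, List.append_nil] at h₁
  have h₂ := runs_move (Γ := Alph A) (τ := CallState A) (k := .inl .c)
    (k' := .inr ⟨i, (A i).tm.k₀⟩) (by simp) id (A i).inputAlphabet.symm
    (idle (update (update s r []) .c w.reverse))
  have h₃ := runs_exec h (update s r [])
  have h₄ := runs_move (Γ := Alph A) (τ := CallState A) (k := .inr ⟨i, (A i).tm.k₁⟩)
    (k' := .inl .c) (by simp) (A i).outputAlphabet id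
    (contents (update s r [])
      (update (fun _ => []) ⟨i, (A i).tm.k₁⟩ (w'.map (A i).outputAlphabet.invFun)))
  have h₅ := runs_flow (A := A) hr.symm (update (update s r []) .c w'.reverse)
  have e₂ : (idle (update (update s r []) .c w.reverse) : ∀ k, List (Alph A k))
      (.inr ⟨i, (A i).tm.k₀⟩) = [] := rfl
  rw [update_idle, hs, idle_inl, update_self, ← List.map_reverse, List.reverse_reverse, e₂,
    List.append_nil, List.length_reverse] at h₂
  have e₂' : update (idle (update s r []) : ∀ k, List (Alph A k)) (.inr ⟨i, (A i).tm.k₀⟩)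
      (w.map fun x => (A i).inputAlphabet.symm (id x)) =
      contents (update s r []) (update (fun _ => []) ⟨i, (A i).tm.k₀⟩
        (w.map (A i).inputAlphabet.invFun)) :=
    update_contents_inr ..
  rw [e₂'] at h₂
  have e₄ : contents (update s r []) (update (fun _ => []) ⟨i, (A i).tm.k₁⟩
      (w'.map (A i).outputAlphabet.invFun)) (.inr ⟨i, (A i).tm.k₁⟩) =
      w'.map (A i).outputAlphabet.invFun := by
    simp [contents]
  have e₄' : contents (update s r []) (update (fun _ => []) ⟨i, (A i).tm.k₁⟩
      (w'.map (A i).outputAlphabet.invFun)) (.inl .c) = [] := by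
    change update s r [] .c = []
    rw [update_of_ne hr.symm, hc]
  have e₄'' : (w'.map (A i).outputAlphabet.invFun).map
      (fun x => id ((A i).outputAlphabet x)) = w' := by
    simp [List.map_map, Function.comp_def]
  have e : update (fun _ => [] : ∀ p : Σ i, (A i).tm.K, List ((A p.1).tm.Γ p.2))
      ⟨i, (A i).tm.k₁⟩ [] = fun _ => [] := update_eq_self_iff.2 rfl
  rw [e₄, e₄', e₄'', update_contents_inr, update_idem, e, update_contents_inl,
    List.append_nil, List.length_map] at h₄
  rw [hs, update_self, update_of_ne hr, update_self, update_idem, List.reverse_reverse,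
    List.append_nil, List.length_reverse] at h₅
  refine (h₁.seq (h₂.seq (h₃.seq (h₄.seq h₅)))).mono ?_
  omega

end Prog

end FairDecision

namespace FairDecision

open Turing Function

/-! ### Closure properties of polynomial-time computability -/

theorem eval_mono (p : Polynomial ℕ) {m n : ℕ} (h : m ≤ n) : p.eval m ≤ p.eval n := by
  rw [Polynomial.eval_eq_sum, Polynomial.eval_eq_sum]
  exact Finset.sum_le_sum fun i _ => Nat.mul_le_mul_left _ (Nat.pow_le_pow_left h i)

/-- The machine `A` computes `f`; the polynomial `p` bounds the time and the length of the output. -/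
def Computes {α β : Type} (A : TM2ComputableAux Bool Bool) (ea : α → Word) (eb : β → Word)
    (f : α → β) (p : Polynomial ℕ) : Prop :=
  ∀ a, Within (TM2.step A.tm.m) (p.eval (ea a).length)
      (initList A.tm ((ea a).map A.inputAlphabet.invFun))
      (haltList A.tm ((eb (f a)).map A.outputAlphabet.invFun)) ∧
    (eb (f a)).length ≤ p.eval (ea a).length

section

variable {α β γ : Type} {ea : α → Word} {eb : β → Word} {ec : γ → Word}

theorem PolyTimeComputable.exists_computes {f : α → β} (h : PolyTimeComputable ea eb f) :
    ∃ A p, Computes A ea eb f p := by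
  obtain ⟨M⟩ := h
  have := M.tm.ΛFin
  have hw := fun a => TM2OutputsInTime.within (M.outputsFun a)
  refine ⟨M.toTM2ComputableAux,
    -- One polynomial for both bounds: it dominates the time, and also the input length plus time
    -- times pushes per step.
    .X + M.time * .C (1 + ∑ l, pushCount (M.tm.m l)), fun a => ⟨(hw a).mono ?_, ?_⟩⟩
  · simp only [Polynomial.eval_add, Polynomial.eval_X, Polynomial.eval_mul, Polynomial.eval_C,
      mul_add, mul_one]
    omega
  · have h := (hw a).length_le M.tm.k₁
    rw [haltList_stk, initList_stk, update_self, List.length_map] at h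
    have h' : (update (fun _ => [] : ∀ k, List (M.tm.Γ k)) M.tm.k₀
        ((ea a).map M.inputAlphabet.invFun) M.tm.k₁).length ≤ (ea a).length := by
      generalize M.tm.k₁ = k
      rcases eq_or_ne k M.tm.k₀ with rfl | hk
      · simp
      · simp [hk]
    simp only [Polynomial.eval_add, Polynomial.eval_X, Polynomial.eval_mul, Polynomial.eval_C,
      mul_add, mul_one]
    omega

/-- Computability in polynomial time only depends on the codes of arguments and values. -/
theorem PolyTimeComputable.of_code_eq {α' β' : Type} {ea' : α' → Word} {eb' : β' → Word}
    {f : α → β} {f' : α' → β'} (h : PolyTimeComputable ea eb f)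
    (hf : ∀ a', ∃ a, ea a = ea' a' ∧ eb (f a) = eb' (f' a')) : PolyTimeComputable ea' eb' f' := by
  obtain ⟨M⟩ := h
  choose g hg₁ hg₂ using hf
  refine ⟨⟨M.toTM2ComputableAux, M.time, fun a' => ?_⟩⟩
  rw [← hg₁, ← hg₂]
  exact M.outputsFun _

theorem polyTimeComputable_of_code_eq {f : α → β} (h : ∀ a, eb (f a) = ea a) :
    PolyTimeComputable ea eb f :=
  PolyTimeComputable.of_code_eq ⟨idComputableInPolyTime ea⟩ fun a => ⟨a, rfl, (h a).symm⟩

variable {I : Type} [DecidableEq I] {A : I → TM2ComputableAux Bool Bool}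

/-- Register `a` serves as input and output stack. A program that ends with all other stacks empty
and the default state ends exactly in `haltList`. -/
theorem polyTimeComputable_of_runs [Fintype I] {f : α → β} (P : RegProg A) (p : Polynomial ℕ)
    (h : ∀ a, P.Runs (idle (regs (ea a) [] [] [])) (idle (regs (eb (f a)) [] [] []))
      (p.eval (ea a).length)) : PolyTimeComputable ea eb f := by
  have _ := fun i => (A i).tm.kFin
  have _ := fun i => (A i).tm.σFin
  let tm : FinTM2 :=
    { K := Stack A
      k₀ := .inl .a
      k₁ := .inl .a
      Γ := Alph A
      Λ := P.Λ
      main := P.main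
      σ := Option Bool × CallState A
      initialState := default
      Γk₀Fin := inferInstanceAs (Fintype Bool)
      m := P.code }
  have e : ∀ w : Word, (update (fun _ => []) (.inl .a) w : ∀ k, List (Alph A k)) =
      idle (regs w [] [] []) := fun w => by
    have : (fun _ => [] : ∀ k, List (Alph A k)) = idle (regs [] [] [] []) := by
      funext k
      rcases k with (_ | _ | _ | _) | _ <;> rfl
    rw [this, update_idle, update_regs_a]
  have hi : ∀ w : Word, initList tm w = ⟨some P.main, default, idle (regs w [] [] [])⟩ :=
    fun w => by rw [← e, ← initList_stk tm w]; rfl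
  have hh : ∀ w : Word, haltList tm w = ⟨none, default, idle (regs w [] [] [])⟩ :=
    fun w => by rw [← e, ← haltList_stk tm w]; rfl
  refine ⟨⟨⟨tm, Equiv.refl Bool, Equiv.refl Bool⟩, p, fun a => ?_⟩⟩
  refine Classical.choice ?_
  obtain ⟨n, hn, hs⟩ := h a
  refine ⟨⟨⟨n, ?_⟩, hn⟩⟩
  have e₁ : ∀ w : Word, w.map (Equiv.refl Bool).invFun = w := fun w => List.map_id w
  rw [e₁, e₁]
  change (flip bind (TM2.step P.code))^[n] (some (initList tm (ea a))) =
    some (haltList tm (eb (f a)))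
  rw [hi, hh]
  exact hs

namespace Prog

/-- The time that a call of a machine takes. -/
noncomputable def callTime (p : Polynomial ℕ) : Polynomial ℕ :=
  -- `p` bounds the run as well as the output length: `p + 4 * p` for running and moving the output,
  -- `4 * .X` for moving the input.
  5 * p + 4 * .X + 4

theorem runs_call_of_computes {i : I} {f : α → β} {p : Polynomial ℕ}
    (h : Computes (A i) ea eb f p) {r : Reg} (hr : r ≠ .c) {s : Reg → Word} (hc : s .c = [])
    (a : α) (ha : s r = ea a) :
    (call i r : RegProg A).Runs (idle s) (idle (update s r (eb (f a))))
      ((callTime p).eval (ea a).length) := by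
  refine (runs_call (h a).1 hr s ha hc).mono ?_
  have := (h a).2
  simp only [callTime, Polynomial.eval_add, Polynomial.eval_mul, Polynomial.eval_X,
    Polynomial.eval_ofNat]
  omega

/-- Push a bit on a register. -/
def pushReg (r : Reg) (x : Bool) : RegProg A := push (.inl r) x

theorem runs_pushReg (r : Reg) (x : Bool) (s : Reg → Word) :
    (pushReg r x : RegProg A).Runs (idle s) (idle (update s r (x :: s r))) 1 := by
  simpa [pushReg] using runs_push (τ := CallState A) (.inl r : Stack A) x (idle s)

/-- Pop a bit from a register and run one of three programs. -/
def caseReg (r : Reg) (Pn Pf Pt : RegProg A) : RegProg A := case (.inl r) id Pn Pf Pt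

theorem Runs.caseReg_nil {r : Reg} {Pn Pf Pt : RegProg A} {s s' : Reg → Word} {t : ℕ}
    (h : s r = []) (hP : Pn.Runs (idle s) (idle s') t) :
    (caseReg r Pn Pf Pt).Runs (idle s) (idle s') (1 + t) :=
  Runs.case_nil h hP

theorem Runs.caseReg_cons {r : Reg} {Pn Pf Pt : RegProg A} {s s' : Reg → Word} {t : ℕ} {x : Bool}
    {w : Word} (h : s r = x :: w)
    (hP : (bif x then Pt else Pf).Runs (idle (update s r w)) (idle s') t) :
    (caseReg r Pn Pf Pt).Runs (idle s) (idle s') (1 + t) :=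
  Runs.case_cons h (by rw [update_idle]; exact hP)

/-- As long as a register is not empty, pop a bit and run one of two programs. -/
def loopReg (r : Reg) (Pf Pt : RegProg A) : RegProg A := loop (.inl r) id Pf Pt

theorem Runs.loopReg_nil {r : Reg} {Pf Pt : RegProg A} {s : Reg → Word} (h : s r = []) :
    (loopReg r Pf Pt).Runs (idle s) (idle s) 1 :=
  Runs.loop_nil h

theorem Runs.loopReg_cons {r : Reg} {Pf Pt : RegProg A} {s s' s'' : Reg → Word} {t t' : ℕ}
    {x : Bool} {w : Word} (h : s r = x :: w)
    (hP : (bif x then Pt else Pf).Runs (idle (update s r w)) (idle s') t)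
    (hL : (loopReg r Pf Pt).Runs (idle s') (idle s'') t') :
    (loopReg r Pf Pt).Runs (idle s) (idle s'') (1 + t + t') :=
  Runs.loop_cons h (by rw [update_idle]; exact hP) hL

/-- Empty a register. -/
def clear (r : Reg) : RegProg A := loopReg r skip skip

theorem runs_clear (r : Reg) (s : Reg → Word) :
    (clear r : RegProg A).Runs (idle s) (idle (update s r [])) (2 * (s r).length + 1) := by
  generalize hl : s r = l
  induction l generalizing s with
  | nil =>
    have e : update s r [] = s := by rw [← hl, update_eq_self]
    rw [e]
    exact Runs.loopReg_nil (A := A) hl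
  | cons x l ih =>
    have := ih (update s r l) (by simp)
    rw [update_idem] at this
    have hx : (bif x then skip else skip : RegProg A).Runs (idle (update s r l))
        (idle (update s r l)) 1 := by
      cases x <;> exact runs_skip _
    refine (Runs.loopReg_cons hl hx this).mono ?_
    simp only [List.length_cons]; omega

/-- Push a word on a register. -/
def pushWord (r : Reg) : Word → RegProg A
  | [] => skip
  | x :: w => (pushWord r w).seq (pushReg r x)

theorem runs_pushWord (r : Reg) (w : Word) (s : Reg → Word) :
    (pushWord r w : RegProg A).Runs (idle s) (idle (update s r (w ++ s r))) (w.length + 1) := by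
  induction w with
  | nil => simpa [pushWord] using runs_skip _
  | cons x w ih => simpa [pushWord] using ih.seq (runs_pushReg r x _)

end Prog

end

/-! ### Splitting the code of a pair -/

/-- The first component of the code of a pair. -/
def fstCode : Word → Word
  | true :: x :: w => x :: fstCode w
  | _ => []

/-- The second component of the code of a pair. -/
def sndCode : Word → Word
  | true :: _ :: w => sndCode w
  | false :: w => w
  | _ => []

theorem fstCode_delimit_append (u v : Word) : fstCode (delimit u ++ v) = u := by
  induction u with
  | nil => simp [delimit, fstCode]
  | cons x u ih => simp [delimit, fstCode, ih]

theorem sndCode_delimit_append (u v : Word) : sndCode (delimit u ++ v) = v := by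
  induction u with
  | nil => simp [delimit, sndCode]
  | cons x u ih => simp [delimit, sndCode, ih]

theorem length_delimit (u : Word) : (delimit u).length = 2 * u.length + 1 := by
  induction u with
  | nil => rfl
  | cons x u ih => simp only [delimit, List.length_cons, ih]; omega

theorem length_sndCode_le (w : Word) : (sndCode w).length ≤ w.length := by
  induction w using sndCode.induct with
  | case1 x w ih => simp only [sndCode, List.length_cons]; omega
  | case2 w => simp [sndCode]
  | case3 w h₁ h₂ => rw [sndCode] <;> simp_all

theorem length_fstCode_le (w : Word) : (fstCode w).length ≤ w.length := by
  induction w using fstCode.induct with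
  | case1 x w ih => simp only [fstCode, List.length_cons]; omega
  | case2 w h => rw [fstCode] <;> simp_all

namespace Prog

variable {I : Type} [DecidableEq I] {A : I → TM2ComputableAux Bool Bool}

/-- Split the pair in register `a`: the second component remains there, and the first component is
pushed, in reverse order, on register `b`. -/
def unpairLoop : RegProg A :=
  -- Register `c` is a flag: the loop pops it, and it is restored only when another bit of the first
  -- component has been read. An end marker or a truncated code stops the loop.
  loopReg .c skip <| caseReg .a skip skip <| caseReg .a skip
    ((pushReg .b false).seq (pushReg .c true)) ((pushReg .b true).seq (pushReg .c true))

def unpair : RegProg A :=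
  (pushReg .c true).seq unpairLoop

theorem runs_unpairLoop (w b d : Word) :
    (unpairLoop : RegProg A).Runs (idle (regs w b [true] d))
      (idle (regs (sndCode w) ((fstCode w).reverse ++ b) [] d)) (5 * w.length + 5) := by
  have done : ∀ s : Reg → Word, s .c = [] → (unpairLoop : RegProg A).Runs (idle s) (idle s) 1 :=
    fun s hs => Runs.loopReg_nil hs
  induction w using sndCode.induct generalizing b with
  | case1 x w ih =>
    have h := ih (x :: b)
    have hb : (bif x then ((pushReg .b true).seq (pushReg .c true))
        else ((pushReg .b false).seq (pushReg .c true)) : RegProg A).Runs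
        (idle (regs w b [] d)) (idle (regs w (x :: b) [true] d)) (1 + 1) := by
      have := (runs_pushReg (A := A) .b x (regs w b [] d)).seq (runs_pushReg .c true _)
      cases x <;> simpa using this
    have hc := Runs.caseReg_cons (r := .a) (Pn := skip) (s := regs (x :: w) b [] d) rfl
      (by simpa using hb)
    have hc' := Runs.caseReg_cons (r := .a) (Pn := skip) (Pf := skip)
      (s := regs (true :: x :: w) b [] d) rfl (by simpa using hc)
    have := Runs.loopReg_cons (r := .c) (Pf := skip) (s := regs (true :: x :: w) b [true] d) rfl
      (by simpa using hc') h
    simp only [sndCode, fstCode, List.reverse_cons, List.append_assoc, List.singleton_append]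
    refine Runs.mono this ?_
    simp only [List.length_cons]; omega
  | case2 w =>
    have hc := Runs.caseReg_cons (A := A) (r := .a) (Pn := skip) (Pf := skip)
      (Pt := caseReg .a skip
        ((pushReg .b false).seq (pushReg .c true)) ((pushReg .b true).seq (pushReg .c true)))
      (s := regs (false :: w) b [] d) (w := w) (s' := regs w b [] d) rfl
      (by simpa using runs_skip (τ := CallState A) _)
    have := Runs.loopReg_cons (r := .c) (Pf := skip) (s := regs (false :: w) b [true] d) rfl
      (by simpa using hc) (done _ rfl)
    simp only [sndCode, fstCode, List.reverse_nil, List.nil_append]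
    refine Runs.mono this ?_
    simp only [List.length_cons]; omega
  | case3 w h₁ h₂ =>
    match w, h₁, h₂ with
    | [], _, _ =>
      have hc := Runs.caseReg_nil (A := A) (r := .a) (Pn := skip) (Pf := skip)
        (Pt := caseReg .a skip
          ((pushReg .b false).seq (pushReg .c true)) ((pushReg .b true).seq (pushReg .c true)))
        (s := regs [] b [] d) rfl (runs_skip _)
      have := Runs.loopReg_cons (r := .c) (Pf := skip) (s := regs [] b [true] d) rfl
        (by simpa using hc) (done _ rfl)
      simp only [sndCode, fstCode, List.reverse_nil, List.nil_append]
      exact Runs.mono this (by omega)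
    | [true], _, _ =>
      have hn := Runs.caseReg_nil (A := A) (r := .a) (Pn := skip)
        (Pf := (pushReg .b false).seq (pushReg .c true))
        (Pt := (pushReg .b true).seq (pushReg .c true))
        (s := regs [] b [] d) rfl (runs_skip (τ := CallState A) _)
      have hc := Runs.caseReg_cons (r := .a) (Pn := skip) (Pf := skip)
        (s := regs [true] b [] d) (w := []) rfl (by simpa using hn)
      have := Runs.loopReg_cons (r := .c) (Pf := skip) (s := regs [true] b [true] d) rfl
        (by simpa using hc) (done _ rfl)
      simp only [sndCode, fstCode, List.reverse_nil, List.nil_append]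
      exact Runs.mono this (by simp)
    | false :: w, _, h₂ => exact absurd rfl (h₂ w)
    | true :: x :: w, h₁, _ => exact absurd rfl (h₁ x w)

theorem runs_unpair (w d : Word) :
    (unpair : RegProg A).Runs (idle (regs w [] [] d))
      (idle (regs (sndCode w) (fstCode w).reverse [] d)) (5 * w.length + 6) := by
  have h := runs_unpairLoop (A := A) w [] d
  rw [List.append_nil] at h
  have := (runs_pushReg (A := A) .c true (regs w [] [] d)).seq (by simpa using h)
  exact this.mono (by omega)

end Prog

end FairDecision

/-! ### Calculus of polynomial-time functions on coded types -/

namespace FairDecision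

open Turing Function

/-- A type whose elements are coded by binary words. -/
class WordCode (α : Type) where
  code : α → Word

open WordCode (code)

instance : WordCode Word := ⟨id⟩

instance : WordCode Bool := ⟨fun x => [x]⟩

instance {α β : Type} [WordCode α] [WordCode β] : WordCode (α × β) :=
  ⟨fun t => delimit (code t.1) ++ code t.2⟩

instance : WordCode (List Word) := ⟨encodeWords⟩

/-- With the code unchanged, `PolyTime` on a subtype is computability under a promise: nothing is
required of the machine on other words. -/
instance {α : Type} [WordCode α] (p : α → Prop) : WordCode (Subtype p) := ⟨fun a => code a.1⟩

/-- `f` is computable in polynomial time. -/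
def PolyTime {α β : Type} [WordCode α] [WordCode β] (f : α → β) : Prop :=
  PolyTimeComputable code code f

namespace PolyTime

variable {α β γ δ : Type} [WordCode α] [WordCode β] [WordCode γ] [WordCode δ]

open Prog

theorem of_code_eq {f : α → β} (h : ∀ a, code (f a) = code a) : PolyTime f :=
  polyTimeComputable_of_code_eq h

theorem id : PolyTime (fun a : α => a) :=
  of_code_eq fun _ => rfl

theorem congr {f g : α → β} (hf : PolyTime f) (h : ∀ a, f a = g a) : PolyTime g :=
  funext h ▸ hf

theorem exists_computes₂ {f : α → β} {g : γ → δ} (hf : PolyTime f) (hg : PolyTime g) :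
    ∃ (A : Bool → TM2ComputableAux Bool Bool) (p : Polynomial ℕ),
      Computes (A false) code code f p ∧ Computes (A true) code code g p := by
  obtain ⟨A, p, hA⟩ := hf.exists_computes
  obtain ⟨B, q, hB⟩ := hg.exists_computes
  refine ⟨fun i => bif i then B else A, p + q, fun a => ⟨(hA a).1.mono ?_, ?_⟩,
    fun a => ⟨(hB a).1.mono ?_, ?_⟩⟩
  · simp
  · exact (hA a).2.trans (by simp)
  · simp
  · exact (hB a).2.trans (by simp)

theorem comp {g : β → γ} {f : α → β} (hg : PolyTime g) (hf : PolyTime f) :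
    PolyTime fun a => g (f a) := by
  obtain ⟨A, p, h₁, h₂⟩ := exists_computes₂ hf hg
  refine polyTimeComputable_of_runs ((call false .a).seq (call true .a) : RegProg A)
    (callTime p + (callTime p).comp p) fun a => ?_
  have r₁ := runs_call_of_computes h₁ (r := .a) (by simp) (s := regs (code a) [] [] []) rfl a rfl
  have r₂ := runs_call_of_computes h₂ (r := .a) (by simp) (s := regs (code (f a)) [] [] []) rfl
    (f a) rfl
  rw [update_regs_a] at r₁ r₂
  refine (r₁.seq r₂).mono ?_
  rw [Polynomial.eval_add, Polynomial.eval_comp]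
  exact Nat.add_le_add_left (eval_mono _ (h₁ a).2) _

/-- Duplicate the contents of register `a`. -/
def duplicate {I : Type} {A : I → TM2ComputableAux Bool Bool} : RegProg A :=
  (flow .a .c).seq <| loopReg .c ((pushReg .a false).seq (pushReg .b false))
    ((pushReg .a true).seq (pushReg .b true))

section

variable {I : Type} [DecidableEq I] {A : I → TM2ComputableAux Bool Bool}

theorem runs_duplicate (w : Word) :
    (duplicate : RegProg A).Runs (idle (regs w [] [] [])) (idle (regs w w [] []))
      (5 * w.length + 2) := by
  have key : ∀ u v : Word, (loopReg .c ((pushReg .a false).seq (pushReg .b false))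
      ((pushReg .a true).seq (pushReg .b true)) : RegProg A).Runs (idle (regs v v u []))
      (idle (regs (u.reverse ++ v) (u.reverse ++ v) [] [])) (3 * u.length + 1) := by
    intro u
    induction u with
    | nil => exact fun v => Runs.loopReg_nil (A := A) rfl
    | cons x u ih =>
      intro v
      have hb : (bif x then (pushReg .a true).seq (pushReg .b true)
          else (pushReg .a false).seq (pushReg .b false) : RegProg A).Runs
          (idle (regs v v u [])) (idle (regs (x :: v) (x :: v) u [])) (1 + 1) := by
        have := (runs_pushReg (A := A) .a x (regs v v u [])).seq (runs_pushReg .b x _)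
        cases x <;> simpa using this
      have := Runs.loopReg_cons (r := .c) (s := regs v v (x :: u) []) rfl (by simpa using hb)
        (ih (x :: v))
      rw [List.reverse_cons, List.append_assoc]
      refine Runs.mono this ?_
      simp only [List.length_cons]; omega
  have h₁ := runs_flow (A := A) (r := .a) (r' := .c) (by simp) (regs w [] [] [])
  have h₂ := key w.reverse []
  simp only [update_regs_a, update_regs_c, regs_a, regs_c, List.append_nil] at h₁
  simp only [List.reverse_reverse, List.append_nil, List.length_reverse] at h₂
  exact (h₁.seq h₂).mono (by omega)

/-- Replace the words in the registers `a` and `b` by the code of the pair in register `a`. -/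
def mkPair : RegProg A :=
  (flow .b .d).seq <| (flow .a .c).seq <| (flow .d .a).seq <| (pushReg .a false).seq <|
    loopReg .c ((pushReg .a false).seq (pushReg .a true))
      ((pushReg .a true).seq (pushReg .a true))

theorem runs_mkPair (u v : Word) :
    (mkPair : RegProg A).Runs (idle (regs u v [] [])) (idle (regs (delimit u ++ v) [] [] []))
      (5 * u.length + 4 * v.length + 5) := by
  have key : ∀ u w : Word, (loopReg .c ((pushReg .a false).seq (pushReg .a true))
      ((pushReg .a true).seq (pushReg .a true)) : RegProg A).Runs
      (idle (regs (delimit w ++ v) [] u []))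
      (idle (regs (delimit (u.reverse ++ w) ++ v) [] [] [])) (3 * u.length + 1) := by
    intro u
    induction u with
    | nil => exact fun v => Runs.loopReg_nil (A := A) rfl
    | cons x u ih =>
      intro w
      have hb : (bif x then (pushReg .a true).seq (pushReg .a true)
          else (pushReg .a false).seq (pushReg .a true) : RegProg A).Runs
          (idle (regs (delimit w ++ v) [] u [])) (idle (regs (delimit (x :: w) ++ v) [] u []))
          (1 + 1) := by
        have := (runs_pushReg (A := A) .a x (regs (delimit w ++ v) [] u [])).seq
          (runs_pushReg .a true _)
        cases x <;> simpa [delimit] using this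
      have := Runs.loopReg_cons (r := .c) (s := regs (delimit w ++ v) [] (x :: u) []) rfl
        (by simpa using hb) (ih (x :: w))
      rw [List.reverse_cons, List.append_assoc]
      refine Runs.mono this ?_
      simp only [List.length_cons]; omega
  have h₁ := runs_flow (A := A) (r := .b) (r' := .d) (by simp) (regs u v [] [])
  have h₂ := runs_flow (A := A) (r := .a) (r' := .c) (by simp) (regs u [] [] v.reverse)
  have h₃ := runs_flow (A := A) (r := .d) (r' := .a) (by simp) (regs [] [] u.reverse v.reverse)
  have h₄ := runs_pushReg (A := A) .a false (regs v [] u.reverse [])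
  have h₅ := key u.reverse []
  simp only [update_regs_a, update_regs_b, update_regs_c, update_regs_d, regs_a, regs_b, regs_c,
    regs_d, List.append_nil, List.reverse_reverse, List.length_reverse] at h₁ h₂ h₃ h₄ h₅
  exact (h₁.seq (h₂.seq (h₃.seq (h₄.seq h₅)))).mono (by omega)

end

theorem pair {f : α → β} {g : α → γ} (hf : PolyTime f) (hg : PolyTime g) :
    PolyTime fun a => (f a, g a) := by
  obtain ⟨A, p, h₁, h₂⟩ := exists_computes₂ hf hg
  refine polyTimeComputable_of_runs
    (duplicate.seq ((call false .a).seq ((call true .b).seq mkPair)) : RegProg A)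
    (5 * .X + 7 + 2 * callTime p + 9 * p) fun a => ?_
  have r₁ := runs_duplicate (A := A) (code a)
  have r₂ := runs_call_of_computes h₁ (r := .a) (by simp) (s := regs (code a) (code a) [] []) rfl
    a rfl
  have r₃ := runs_call_of_computes h₂ (r := .b) (by simp) (s := regs (code (f a)) (code a) [] [])
    rfl a rfl
  rw [update_regs_a] at r₂
  rw [update_regs_b] at r₃
  have r₄ := runs_mkPair (A := A) (code (f a)) (code (g a))
  refine (r₁.seq (r₂.seq (r₃.seq r₄))).mono ?_
  have b₁ := (h₁ a).2
  have b₂ := (h₂ a).2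
  simp only [Polynomial.eval_add, Polynomial.eval_mul, Polynomial.eval_X,
    Polynomial.eval_ofNat]
  omega

/-- A family without machines, for programs without calls. -/
def noCalls (i : Empty) : TM2ComputableAux Bool Bool := i.elim

theorem fstCode : PolyTime FairDecision.fstCode := by
  refine polyTimeComputable_of_runs
    (unpair.seq ((clear .a).seq (flow .b .a)) : RegProg noCalls) (9 * .X + 8) fun w => ?_
  have r₁ := runs_unpair (A := noCalls) w []
  have r₂ := runs_clear (A := noCalls) .a (regs (sndCode w) (FairDecision.fstCode w).reverse [] [])
  have r₃ := runs_flow (A := noCalls) (r := .b) (r' := .a) (by simp)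
    (regs [] (FairDecision.fstCode w).reverse [] [])
  simp only [update_regs_a, update_regs_b, regs_a, regs_b, List.append_nil, List.reverse_reverse,
    List.length_reverse] at r₂ r₃
  refine (r₁.seq (r₂.seq r₃)).mono ?_
  have b₁ := length_fstCode_le w
  have b₂ := length_sndCode_le w
  simp only [Polynomial.eval_add, Polynomial.eval_mul, Polynomial.eval_X,
    Polynomial.eval_ofNat]
  change _ ≤ 9 * w.length + 8
  omega

theorem sndCode : PolyTime FairDecision.sndCode := by
  refine polyTimeComputable_of_runs (unpair.seq (clear .b) : RegProg noCalls) (7 * .X + 7)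
    fun w => ?_
  have r₁ := runs_unpair (A := noCalls) w []
  have r₂ := runs_clear (A := noCalls) .b
    (regs (FairDecision.sndCode w) (FairDecision.fstCode w).reverse [] [])
  simp only [update_regs_b, regs_b, List.length_reverse] at r₂
  refine (r₁.seq r₂).mono ?_
  have b₁ := length_fstCode_le w
  simp only [Polynomial.eval_add, Polynomial.eval_mul, Polynomial.eval_X,
    Polynomial.eval_ofNat]
  change _ ≤ 7 * w.length + 7
  omega

theorem fst : PolyTime (Prod.fst : α × β → α) :=
  PolyTimeComputable.of_code_eq fstCode fun t => ⟨code t, rfl, fstCode_delimit_append _ _⟩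

theorem snd : PolyTime (Prod.snd : α × β → β) :=
  PolyTimeComputable.of_code_eq sndCode fun t => ⟨code t, rfl, sndCode_delimit_append _ _⟩

/-- The code of `w :: ws` is the code of the pair `(w, ws)`, and `fstCode` sends the empty word to
the default value `[]`. -/
theorem headWord : PolyTime fun ws : List Word => ws.headD [] :=
  PolyTimeComputable.of_code_eq fstCode fun ws => ⟨code ws, rfl, by
    cases ws with
    | nil => rfl
    | cons w ws => exact fstCode_delimit_append _ _⟩

theorem tailWords : PolyTime fun ws : List Word => ws.tail :=
  PolyTimeComputable.of_code_eq sndCode fun ws => ⟨code ws, rfl, by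
    cases ws with
    | nil => rfl
    | cons w ws => exact sndCode_delimit_append _ _⟩

theorem const (b : β) : PolyTime fun _ : α => b := by
  refine polyTimeComputable_of_runs ((clear .a).seq (pushWord .a (code b)) : RegProg noCalls)
    (2 * .X + .C ((code b).length + 2)) fun a => ?_
  have r₁ := runs_clear (A := noCalls) .a (regs (code a) [] [] [])
  have r₂ := runs_pushWord (A := noCalls) .a (code b) (regs [] [] [] [])
  simp only [update_regs_a, regs_a, List.append_nil] at r₁ r₂
  refine (r₁.seq r₂).mono ?_
  simp only [Polynomial.eval_add, Polynomial.eval_mul, Polynomial.eval_X, Polynomial.eval_C,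
    Polynomial.eval_ofNat]
  omega

/-- The machine that inspects the first bit of a word. -/
theorem casesWord (n f t : Bool) :
    PolyTime fun w : Word => (w.head?.elim n fun x => bif x then t else f) := by
  refine polyTimeComputable_of_runs (caseReg .a (pushReg .a n) ((clear .a).seq (pushReg .a f))
    ((clear .a).seq (pushReg .a t)) : RegProg noCalls) (2 * .X + 3) fun w => ?_
  have key : ∀ (x : Bool) (w : Word), ((clear .a).seq (pushReg .a x) : RegProg noCalls).Runs
      (idle (regs w [] [] [])) (idle (regs [x] [] [] [])) (2 * w.length + 1 + 1) := fun x w => by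
    simpa using (runs_clear (A := noCalls) .a (regs w [] [] [])).seq (runs_pushReg .a x _)
  cases w with
  | nil =>
    have h := runs_pushReg (A := noCalls) .a n (regs [] [] [] [])
    rw [update_regs_a] at h
    exact (Runs.caseReg_nil (r := .a) rfl h).mono (by simp)
  | cons x w =>
    refine (Runs.caseReg_cons (A := noCalls) (s := regs (x :: w) [] [] [])
      (s' := regs [bif x then t else f] [] [] []) (t := 2 * w.length + 1 + 1) rfl ?_).mono ?_
    · rw [update_regs_a]
      cases x
      · exact key f w
      · exact key t w
    · change _ ≤ Polynomial.eval (w.length + 1) _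
      simp only [Polynomial.eval_add, Polynomial.eval_mul, Polynomial.eval_X,
        Polynomial.eval_ofNat]
      omega

theorem isEmpty : PolyTime fun w : Word => w.isEmpty :=
  (casesWord true false false).congr fun w => by cases w <;> simp

theorem headBit : PolyTime fun w : Word => w.headD false :=
  (casesWord false false true).congr fun w => by rcases w with _ | ⟨_ | _, w⟩ <;> rfl

theorem isEmptyWords : PolyTime fun ws : List Word => ws.isEmpty :=
  PolyTimeComputable.of_code_eq isEmpty fun ws => ⟨code ws, rfl, by
    rcases ws with _ | ⟨_ | _, ws⟩ <;> rfl⟩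

theorem tailBits : PolyTime fun w : Word => w.tail := by
  refine polyTimeComputable_of_runs (caseReg .a skip skip skip : RegProg noCalls) 2 fun w => ?_
  cases w with
  | nil => exact (Runs.caseReg_nil (A := noCalls) rfl (runs_skip _)).mono (by simp)
  | cons x w =>
    refine (Runs.caseReg_cons (A := noCalls) (s := regs (x :: w) [] [] [])
      (s' := regs w [] [] []) (t := 1) rfl ?_).mono (by simp)
    rw [update_regs_a]
    cases x <;> exact runs_skip _

/-- Definition by cases; each case has to be computable on the arguments it applies to only. -/
theorem dite {p : α → Bool} (hp : PolyTime p) {f : {a // p a = true} → β}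
    {g : {a // p a = false} → β} (hf : PolyTime f) (hg : PolyTime g) {h : α → β}
    (h₁ : ∀ a (ha : p a = true), h a = f ⟨a, ha⟩)
    (h₂ : ∀ a (ha : p a = false), h a = g ⟨a, ha⟩) : PolyTime h := by
  obtain ⟨A, q, hA, hB⟩ := exists_computes₂ hg hf
  -- The subtype records that the stored bit is the value of `p`, so that the machine chosen by this
  -- bit is called within its promise.
  have hpair : PolyTime fun a => (⟨(p a, a), rfl⟩ : {t : Bool × α // p t.2 = t.1}) :=
    PolyTimeComputable.of_code_eq (hp.pair id) fun a => ⟨a, rfl, rfl⟩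
  have hdisp : PolyTime fun t : {t : Bool × α // p t.2 = t.1} => h t.1.2 := by
    -- The code of `(x, a)` is `true :: x :: false :: code a`. Three pops remove the prefix and
    -- select the machine; the branches with `skip` are never reached.
    refine polyTimeComputable_of_runs (caseReg .a skip skip <|
      caseReg .a skip (caseReg .a skip (call false .a) skip)
        (caseReg .a skip (call true .a) skip) : RegProg A) (3 + callTime q) fun t => ?_
    obtain ⟨⟨x, a⟩, ha⟩ := t
    have key : ∀ t, (call x .a : RegProg A).Runs (idle (regs (code a) [] [] []))
        (idle (regs (code (h a)) [] [] [])) t →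
        (caseReg .a skip skip (caseReg .a skip (caseReg .a skip (call false .a) skip)
          (caseReg .a skip (call true .a) skip)) : RegProg A).Runs
          (idle (regs (true :: x :: false :: code a) [] [] []))
          (idle (regs (code (h a)) [] [] [])) (1 + (1 + (1 + t))) := by
      intro t ht
      refine Runs.caseReg_cons rfl (Runs.caseReg_cons rfl ?_)
      cases x <;> refine Runs.caseReg_cons rfl ?_ <;> simpa using ht
    have hcall : (call x .a : RegProg A).Runs (idle (regs (code a) [] [] []))
        (idle (regs (code (h a)) [] [] [])) ((callTime q).eval (code a).length) := by
      cases x with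
      | false =>
        have := runs_call_of_computes hA (r := .a) (by simp) (s := regs (code a) [] [] []) rfl
          ⟨a, ha⟩ rfl
        rw [update_regs_a] at this
        rw [h₂ a ha]
        exact this
      | true =>
        have := runs_call_of_computes hB (r := .a) (by simp) (s := regs (code a) [] [] []) rfl
          ⟨a, ha⟩ rfl
        rw [update_regs_a] at this
        rw [h₁ a ha]
        exact this
    refine (key _ hcall).mono ?_
    have hl : (code a).length ≤ (true :: x :: false :: code a).length := by
      simp only [List.length_cons]; omega
    have := eval_mono (callTime q) hl
    change _ ≤ (3 + callTime q).eval (true :: x :: false :: code a).length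
    simp only [Polynomial.eval_add, Polynomial.eval_ofNat]
    omega
  exact hdisp.comp hpair

theorem cond {p : α → Bool} {f g : α → β} (hp : PolyTime p) (hf : PolyTime f) (hg : PolyTime g) :
    PolyTime fun a => bif p a then f a else g a :=
  dite hp (f := fun a => f a.1) (g := fun a => g a.1)
    (PolyTimeComputable.of_code_eq hf fun a => ⟨a.1, rfl, rfl⟩)
    (PolyTimeComputable.of_code_eq hg fun a => ⟨a.1, rfl, rfl⟩)
    (fun a ha => by simp [ha]) fun a ha => by simp [ha]

theorem and {p q : α → Bool} (hp : PolyTime p) (hq : PolyTime q) :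
    PolyTime fun a => p a && q a :=
  (cond hp hq (const false)).congr fun a => by cases p a <;> simp

theorem or {p q : α → Bool} (hp : PolyTime p) (hq : PolyTime q) :
    PolyTime fun a => p a || q a :=
  (cond hp (const true) hq).congr fun a => by cases p a <;> simp

theorem not {p : α → Bool} (hp : PolyTime p) : PolyTime fun a => !p a :=
  (cond hp (const false) (const true)).congr fun a => by cases p a <;> simp

/-- Iteration along a word, if the intermediate results have polynomial size. -/
theorem foldl {step : Bool × β → β} (hstep : PolyTime step) (q : Polynomial ℕ)
    (hq : ∀ (u : Word) (s : β), (code (u.foldl (fun s x => step (x, s)) s)).length ≤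
      q.eval (u.length + (code s).length)) :
    PolyTime fun t : Word × β => t.1.foldl (fun s x => step (x, s)) t.2 := by
  obtain ⟨A, p, hA⟩ := hstep.exists_computes
  let body (x : Bool) : RegProg fun _ : Unit => A :=
    -- The three pushes turn the code of `s` into that of `(x, s)`.
    (pushReg .a false).seq <| (pushReg .a x).seq <| (pushReg .a true).seq <| call () .a
  have hbody : ∀ (x : Bool) (s : β) (u : Word), (body x).Runs (idle (regs (code s) [] [] u))
      (idle (regs (code (step (x, s))) [] [] u))
      (3 + (callTime p).eval (3 + (code s).length)) := by
    intro x s u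
    have r₁ := runs_pushReg (A := fun _ : Unit => A) .a false (regs (code s) [] [] u)
    have r₂ := runs_pushReg (A := fun _ : Unit => A) .a x (regs (false :: code s) [] [] u)
    have r₃ := runs_pushReg (A := fun _ : Unit => A) .a true (regs (x :: false :: code s) [] [] u)
    have r₄ := runs_call_of_computes (A := fun _ : Unit => A) (i := ()) hA (r := .a) (by simp)
      (s := regs (true :: x :: false :: code s) [] [] u) rfl (x, s) rfl
    rw [update_regs_a] at r₁ r₂ r₃ r₄
    refine (r₁.seq (r₂.seq (r₃.seq r₄))).mono ?_
    have e : (code (x, s)).length = 3 + (code s).length := by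
      change (true :: x :: false :: code s).length = _
      simp only [List.length_cons]; omega
    rw [e]
    omega
  have hloop : ∀ (u : Word) (s : β) (B : ℕ),
      (∀ v, v <+: u → (code (v.foldl (fun s x => step (x, s)) s)).length ≤ B) →
      (loopReg .d (body false) (body true)).Runs (idle (regs (code s) [] [] u))
        (idle (regs (code (u.foldl (fun s x => step (x, s)) s)) [] [] []))
        (u.length * (4 + (callTime p).eval (3 + B)) + 1) := by
    intro u
    induction u with
    | nil => exact fun s B _ => (Runs.loopReg_nil rfl).mono (by simp)
    | cons x u ih =>
      intro s B hB
      have h := ih (step (x, s)) B fun v hv => hB (x :: v) (by simpa using hv)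
      have hb : (bif x then body true else body false).Runs (idle (regs (code s) [] [] u))
          (idle (regs (code (step (x, s))) [] [] u))
          (3 + (callTime p).eval (3 + (code s).length)) := by
        cases x <;> exact hbody _ s u
      have hs : (code s).length ≤ B := hB [] (List.nil_prefix)
      have := Runs.loopReg_cons (r := .d) (s := regs (code s) [] [] (x :: u)) rfl
        (by simpa using hb) h
      refine Runs.mono this ?_
      have := eval_mono (callTime p) (Nat.add_le_add_left hs 3)
      rw [List.length_cons, add_mul, one_mul]
      omega
  refine polyTimeComputable_of_runs
    -- `unpair` leaves the word reversed in `b`; moving it to `d` restores the order and keeps it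
    -- out of reach of the calls, which use `c`.
    (unpair.seq ((flow .b .d).seq (loopReg .d (body false) (body true))))
    (7 * .X + 8 + .X * (4 + (callTime p).comp (3 + q))) fun t => ?_
  obtain ⟨u, s⟩ := t
  have r₁ := runs_unpair (A := fun _ : Unit => A) (delimit u ++ code s) []
  rw [fstCode_delimit_append, sndCode_delimit_append] at r₁
  have r₂ := runs_flow (A := fun _ : Unit => A) (r := .b) (r' := .d) (by simp)
    (regs (code s) u.reverse [] [])
  simp only [update_regs_b, update_regs_d, regs_b, regs_d, List.append_nil, List.reverse_reverse,
    List.length_reverse] at r₂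
  have hl : u.length + (code s).length ≤ (delimit u ++ code s).length := by
    rw [List.length_append, length_delimit]; omega
  have r₃ := hloop u s (q.eval (delimit u ++ code s).length) fun v hv =>
    (hq v s).trans (eval_mono q ((Nat.add_le_add_right hv.length_le _).trans hl))
  refine (r₁.seq (r₂.seq r₃)).mono ?_
  change _ ≤ Polynomial.eval (delimit u ++ code s).length _
  simp only [Polynomial.eval_add, Polynomial.eval_mul, Polynomial.eval_X, Polynomial.eval_comp,
    Polynomial.eval_ofNat]
  have hu : u.length ≤ (delimit u ++ code s).length := by omega
  have := Nat.mul_le_mul_right (4 + (callTime p).eval (3 + q.eval (delimit u ++ code s).length)) hu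
  omega

end PolyTime

end FairDecision

namespace FairDecision

open WordCode (code)

/-! ### Decoding of sequences of words -/

@[simp] theorem encodeWords_nil : encodeWords [] = [] := rfl

@[simp] theorem encodeWords_cons (w : Word) (ws : List Word) :
    encodeWords (w :: ws) = delimit w ++ encodeWords ws := rfl

theorem encodeWords_injective : Function.Injective encodeWords := by
  intro ws
  induction ws with
  | nil =>
    intro vs h
    rcases vs with _ | ⟨_ | _, vs⟩
    · rfl
    all_goals simp [delimit] at h
  | cons w ws ih =>
    intro vs h
    rcases vs with _ | ⟨v, vs⟩
    · cases w <;> simp [delimit] at h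
    · have h₁ := congrArg fstCode h
      have h₂ := congrArg sndCode h
      simp only [encodeWords_cons, fstCode_delimit_append, sndCode_delimit_append] at h₁ h₂
      rw [h₁, ih h₂]

/-- Transitions of the automaton that recognizes codes of sequences of words. The first component of
the state tells whether a bit is expected, the second one whether we are inside a word. -/
def codeStep (t : Bool × Bool × Bool) : Bool × Bool :=
  bif t.2.1 then (false, true) else bif t.1 then (true, t.2.2) else (false, false)

/-- Does the automaton, started in the state `s`, accept the word `w`? -/
def acceptsCode (s : Bool × Bool) (w : Word) : Bool :=
  let r := w.foldl (fun s x => codeStep (x, s)) s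
  !r.1 && !r.2

/-- Generalized over `i` for the induction: inside a word the end marker is still due, so the empty
rest is accepted only for `i = false`. -/
theorem acceptsCode_iff : ∀ (w : Word) (i : Bool), acceptsCode (false, i) w = true ↔
    (∃ u ws, delimit u ++ encodeWords ws = w) ∨ (i = false ∧ w = [])
  | true :: x :: w, i => by
    have e : acceptsCode (false, i) (true :: x :: w) = acceptsCode (false, true) w := rfl
    rw [e, acceptsCode_iff w]
    constructor
    · rintro (⟨u, ws, rfl⟩ | h)
      · exact .inl ⟨x :: u, ws, rfl⟩
      · simp at h
    · rintro (⟨u, ws, h⟩ | h)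
      · rcases u with _ | ⟨y, u⟩
        · simp [delimit] at h
        · simp only [delimit, List.cons_append, List.cons.injEq, true_and] at h
          exact .inl ⟨u, ws, h.2⟩
      · simp at h
  | false :: w, i => by
    have e : acceptsCode (false, i) (false :: w) = acceptsCode (false, false) w := rfl
    rw [e, acceptsCode_iff w]
    constructor
    · rintro (⟨u, ws, rfl⟩ | ⟨-, rfl⟩)
      · exact .inl ⟨[], u :: ws, rfl⟩
      · exact .inl ⟨[], [], rfl⟩
    · rintro (⟨u, ws, h⟩ | h)
      · rcases u with _ | ⟨y, u⟩
        · simp only [delimit, List.cons_append, List.nil_append, List.cons.injEq, true_and] at h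
          rcases ws with _ | ⟨v, ws⟩
          · exact .inr ⟨rfl, h.symm⟩
          · exact .inl ⟨v, ws, h⟩
        · simp [delimit] at h
      · simp at h
  | [], i => by
    have : ∀ u ws, delimit u ++ encodeWords ws ≠ [] := fun u ws => by cases u <;> simp [delimit]
    simp [acceptsCode, this]
  | [true], i => by
    have : ∀ u ws, delimit u ++ encodeWords ws ≠ [true] := fun u ws => by
      cases u <;> simp [delimit]
    simp [acceptsCode, codeStep, this]

/-- Is the word the code of a sequence of words? -/
def isCode (w : Word) : Bool := acceptsCode (false, false) w

theorem isCode_iff (w : Word) : isCode w = true ↔ ∃ ws, encodeWords ws = w := by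
  rw [isCode, acceptsCode_iff]
  constructor
  · rintro (⟨u, ws, h⟩ | ⟨-, rfl⟩)
    · exact ⟨u :: ws, h⟩
    · exact ⟨[], rfl⟩
  · rintro ⟨_ | ⟨u, ws⟩, h⟩
    · exact .inr ⟨rfl, h.symm⟩
    · exact .inl ⟨u, ws, h⟩

open scoped Classical in
/-- The sequence of words with a given code, or the empty sequence. -/
noncomputable def decodeWords (w : Word) : List Word :=
  if h : ∃ ws, encodeWords ws = w then h.choose else []

theorem decodeWords_encodeWords (ws : List Word) : decodeWords (encodeWords ws) = ws := by
  have h : ∃ vs, encodeWords vs = encodeWords ws := ⟨ws, rfl⟩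
  rw [decodeWords, dif_pos h]
  exact encodeWords_injective h.choose_spec

theorem encodeWords_decodeWords {w : Word} (h : isCode w = true) :
    encodeWords (decodeWords w) = w := by
  obtain ⟨ws, rfl⟩ := (isCode_iff w).1 h
  rw [decodeWords_encodeWords]

/-! ### Tests along a word -/

/-- Check a condition for each bit of a word while an argument is shortened in parallel. -/
def scan {γ : Type} (chk : Bool → γ → Bool) (tl : γ → γ) (fin : γ → Bool) : Word → γ → Bool
  | [], s => fin s
  | x :: u, s => chk x s && scan chk tl fin u (tl s)

/-- Equality of words. -/
def eqWord : Word → Word → Bool :=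
  scan (fun x v => !v.isEmpty && bif x then v.headD false else !v.headD false) List.tail
    List.isEmpty

def sameLength : Word → List Word → Bool :=
  scan (fun _ ws => !ws.isEmpty) List.tail List.isEmpty

/-- Inclusion of the sets with given characteristic words. -/
def subsetTest : Word → Word → Bool :=
  scan (fun x v => !x || v.headD false) List.tail fun _ => true

/-- Disjointness of the sets with given characteristic words. -/
def disjointTest : Word → Word → Bool :=
  scan (fun x v => !(x && v.headD false)) List.tail fun _ => true

/-- Agreement of two lists of words on the set with a given characteristic word. -/
def agreeTest (S : Word) (xs ys : List Word) : Bool :=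
  scan (fun x (t : List Word × List Word) => !x || eqWord (t.1.headD []) (t.2.headD []))
    (fun t => (t.1.tail, t.2.tail)) (fun _ => true) S (xs, ys)

theorem eqWord_iff (u v : Word) : eqWord u v = true ↔ u = v := by
  induction u generalizing v with
  | nil => cases v <;> simp [eqWord, scan]
  | cons x u ih =>
    rcases v with _ | ⟨y, v⟩
    · simp [eqWord, scan]
    · have e : eqWord (x :: u) (y :: v) = ((bif x then y else !y) && eqWord u v) := rfl
      cases x <;> cases y <;> simp [e, ih]

theorem sameLength_iff (u : Word) (ws : List Word) :
    sameLength u ws = true ↔ u.length = ws.length := by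
  induction u generalizing ws with
  | nil => cases ws <;> simp [sameLength, scan]
  | cons x u ih =>
    rw [sameLength] at ih
    cases ws <;> simp [sameLength, scan, ih]

theorem subsetTest_ofFn {n : ℕ} (s t : Fin n → Bool) :
    subsetTest (List.ofFn s) (List.ofFn t) = true ↔ ∀ i, s i = true → t i = true := by
  induction n with
  | zero => simp [subsetTest, scan]
  | succ n ih =>
    have := ih (fun i => s i.succ) fun i => t i.succ
    rw [subsetTest] at this
    rw [Fin.forall_fin_succ, ← this]
    cases h : s 0 <;> simp [subsetTest, scan, h]

theorem disjointTest_ofFn {n : ℕ} (s t : Fin n → Bool) :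
    disjointTest (List.ofFn s) (List.ofFn t) = true ↔ ∀ i, s i = true → ¬ t i = true := by
  induction n with
  | zero => simp [disjointTest, scan]
  | succ n ih =>
    have := ih (fun i => s i.succ) fun i => t i.succ
    rw [disjointTest] at this
    rw [Fin.forall_fin_succ, ← this]
    cases h : s 0 <;> simp [disjointTest, scan, h]

theorem agreeTest_ofFn {n : ℕ} (s : Fin n → Bool) (x y : Fin n → Word) :
    agreeTest (List.ofFn s) (List.ofFn x) (List.ofFn y) = true ↔
      ∀ i, s i = true → x i = y i := by
  induction n with
  | zero => simp [agreeTest, scan]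
  | succ n ih =>
    have := ih (fun i => s i.succ) (fun i => x i.succ) fun i => y i.succ
    rw [agreeTest] at this
    rw [Fin.forall_fin_succ, ← this]
    cases h : s 0 <;> simp [agreeTest, scan, h, eqWord_iff]

/-! ### The decoder and the tests run in polynomial time -/

namespace PolyTime

variable {α β γ : Type} [WordCode α] [WordCode β] [WordCode γ]

theorem codeStep : PolyTime FairDecision.codeStep :=
  cond (fst.comp snd) (const _) (cond fst (pair (const true) (snd.comp snd)) (const _))

theorem isCode : PolyTime FairDecision.isCode := by
  have h := foldl codeStep (.C 4) fun u s => by simp [WordCode.code, delimit]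
  have h' : PolyTime fun w : Word => (w.foldl (fun s x => FairDecision.codeStep (x, s))
      (false, false) : Bool × Bool) :=
    h.comp (pair id (const (false, false)))
  exact and (not (fst.comp h')) (not (snd.comp h'))

/-- Decoding does not change the bits: on codes the identity machine computes it, elsewhere the
value is constant. -/
theorem decodeWords : PolyTime FairDecision.decodeWords :=
  dite isCode (f := fun w => FairDecision.decodeWords w.1) (g := fun _ => [])
    (of_code_eq fun w => encodeWords_decodeWords w.2) (const []) (fun _ _ => rfl) fun w hw => by
      have : ¬ ∃ ws, encodeWords ws = w := by rw [← isCode_iff, hw]; simp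
      rw [FairDecision.decodeWords, dif_neg this]

/-- A scan is a fold that carries the conjunction of the checks made so far. As `tl` does not
lengthen codes, the states of the fold do not grow. -/
theorem scan {chk : Bool → γ → Bool} {tl : γ → γ} {fin : γ → Bool}
    (hchk : PolyTime fun t : Bool × γ => chk t.1 t.2) (htl : PolyTime tl) (hfin : PolyTime fin)
    (hlen : ∀ s, (code (tl s)).length ≤ (code s).length) :
    PolyTime fun t : Word × γ => FairDecision.scan chk tl fin t.1 t.2 := by
  let step (t : Bool × Bool × γ) : Bool × γ := (t.2.1 && chk t.1 t.2.2, tl t.2.2)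
  have hstep : PolyTime step :=
    pair (and (fst.comp snd) (hchk.comp (pair fst (snd.comp snd)))) (htl.comp (snd.comp snd))
  have hl : ∀ (u : Word) (s : Bool × γ),
      (code (u.foldl (fun s x => step (x, s)) s)).length ≤ (code s).length := by
    intro u
    induction u with
    | nil => exact fun s => le_rfl
    | cons x u ih =>
      intro s
      refine (ih _).trans ?_
      change (delimit [_] ++ code (tl s.2)).length ≤ (delimit [_] ++ code s.2).length
      simp only [List.length_append, length_delimit, List.length_singleton]
      have := hlen s.2
      omega
  have hfold := foldl hstep .X fun u s => (hl u s).trans (by simp)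
  have hspec : ∀ (u : Word) (b : Bool) (s : γ),
      ((u.foldl (fun s x => step (x, s)) (b, s)).1 &&
        fin (u.foldl (fun s x => step (x, s)) (b, s)).2) =
      (b && FairDecision.scan chk tl fin u s) := by
    intro u
    induction u with
    | nil => exact fun b s => rfl
    | cons x u ih =>
      intro b s
      rw [List.foldl_cons, ih]
      simp [FairDecision.scan, Bool.and_assoc]
  have h : PolyTime fun t : Word × γ => t.1.foldl (fun s x => step (x, s)) (true, t.2) :=
    hfold.comp (pair fst (pair (const true) snd))
  refine (and (fst.comp h) (hfin.comp (snd.comp h))).congr fun t => ?_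
  rw [hspec, Bool.true_and]

theorem length_tail_le (w : Word) : (code w.tail).length ≤ (code w).length := by
  change w.tail.length ≤ w.length
  simp

theorem length_tailWords_le (ws : List Word) : (code ws.tail).length ≤ (code ws).length := by
  change (encodeWords ws.tail).length ≤ (encodeWords ws).length
  cases ws <;> simp

theorem eqWord {u v : α → Word} (hu : PolyTime u) (hv : PolyTime v) :
    PolyTime fun a => FairDecision.eqWord (u a) (v a) :=
  (scan (γ := Word)
    (chk := fun x v => !v.isEmpty && bif x then v.headD false else !v.headD false)
    (and (not (isEmpty.comp snd)) (cond fst (headBit.comp snd) (not (headBit.comp snd))))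
    tailBits isEmpty length_tail_le).comp (pair hu hv)

theorem sameLength {u : α → Word} {v : α → List Word} (hu : PolyTime u) (hv : PolyTime v) :
    PolyTime fun a => FairDecision.sameLength (u a) (v a) :=
  (scan (not (isEmptyWords.comp snd)) tailWords isEmptyWords length_tailWords_le).comp (pair hu hv)

theorem subsetTest {u v : α → Word} (hu : PolyTime u) (hv : PolyTime v) :
    PolyTime fun a => FairDecision.subsetTest (u a) (v a) :=
  (scan (γ := Word) (chk := fun x v => !x || v.headD false)
    (or (not fst) (headBit.comp snd)) tailBits (const true) length_tail_le).comp (pair hu hv)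

theorem disjointTest {u v : α → Word} (hu : PolyTime u) (hv : PolyTime v) :
    PolyTime fun a => FairDecision.disjointTest (u a) (v a) :=
  (scan (not (and fst (headBit.comp snd))) tailBits (const true) length_tail_le).comp (pair hu hv)

theorem agreeTest {u : α → Word} {v w : α → List Word} (hu : PolyTime u) (hv : PolyTime v)
    (hw : PolyTime w) : PolyTime fun a => FairDecision.agreeTest (u a) (v a) (w a) := by
  refine (scan (γ := List Word × List Word) (or (not fst) (eqWord (headWord.comp (fst.comp snd))
    (headWord.comp (snd.comp snd)))) (pair (tailWords.comp fst) (tailWords.comp snd)) (const true)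
    fun s => ?_).comp (pair hu (pair hv hw))
  change (delimit (code s.1.tail) ++ code s.2.tail).length ≤ (delimit (code s.1) ++ code s.2).length
  rw [List.length_append, List.length_append, length_delimit, length_delimit]
  have h₁ := length_tailWords_le s.1
  have h₂ := length_tailWords_le s.2
  omega

end PolyTime

end FairDecision

namespace FairDecision

/-! ### PI-explanations by quantifiers over feature vectors -/

section Explanations

variable {n : ℕ} {D : Fin n → Type} {K : Type} {C : Set (∀ i, D i)} {κ : C → K} {x : C}

theorem AgreeOn.mono {S T : Finset (Fin n)} (h : S ⊆ T) {y z : ∀ i, D i} (hT : AgreeOn T y z) :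
    AgreeOn S y z :=
  fun i hi => hT i (h hi)

theorem IsWeakAXp.exists_isAXp {T : Finset (Fin n)} (hT : IsWeakAXp C κ x T) :
    ∃ T' ⊆ T, IsAXp C κ x T' := by
  obtain ⟨T', hle, hmin⟩ := exists_minimal_le_of_wellFoundedLT (IsWeakAXp C κ x) T hT
  exact ⟨T', hle, hmin⟩

/-- The first clause makes `S` a weak AXp. The second treats an arbitrary `T`, not assumed to be an
AXp; its first two alternatives do not mention `y`, so `z` can be chosen last. -/
theorem isPIExplanation_iff {S : Finset (Fin n)} :
    IsPIExplanation C κ x S ↔ ∀ (T : Finset (Fin n)) (y : C),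
      (AgreeOn S y.1 x.1 → κ y = κ x) ∧
      ((∃ z : C, (AgreeOn T z.1 x.1 ∧ κ z ≠ κ x) ∨ (AgreeOn S z.1 x.1 ∧ ¬ AgreeOn T z.1 x.1)) ∨
        ((AgreeOn T y.1 x.1 → AgreeOn S y.1 x.1) ∧ ¬ T ⊂ S)) := by
  constructor
  · rintro ⟨hS, hmax⟩ T y
    refine ⟨hS.prop y, or_iff_not_imp_left.2 fun hz => ?_⟩
    push Not at hz
    have hT : IsWeakAXp C κ x T := fun z hz' => (hz z).1 hz'
    have hTS : Subsumes C x T S := fun z hz' => (hz z).2 hz'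
    refine ⟨?_, fun h => h.2 (hS.le_of_le hT h.1)⟩
    -- The definition speaks of AXps only, so `T` is shrunk to one. Agreement on `T` implies
    -- agreement on `T'`, so the conclusion carries over to `T`.
    obtain ⟨T', hT', hax⟩ := hT.exists_isAXp
    have := hmax T' hax
    rw [StrictlySubsumes, not_and, not_not] at this
    intro hy
    exact this (fun z hz' => (hTS z hz').mono hT') y (hy.mono hT')
  · intro h
    have hS : IsWeakAXp C κ x S := fun y => (h S y).1
    refine ⟨⟨hS, fun T hT hle => ?_⟩, fun T hT hstrict => ?_⟩
    · by_contra hnle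
      -- Only the clause `¬ T ⊂ S` is used here, so any feasible vector would do for `y`.
      rcases (h T x).2 with ⟨z, ⟨hz, hne⟩ | ⟨hz, hne⟩⟩ | ⟨-, hn⟩
      · exact hne (hT z hz)
      · exact hne (hz.mono hle)
      · exact hn ⟨hle, hnle⟩
    · refine hstrict.2 fun y hy => ?_
      rcases (h T y).2 with ⟨z, ⟨hz, hne⟩ | ⟨hz, hne⟩⟩ | ⟨hy', -⟩
      · exact absurd (hT.prop z hz) hne
      · exact absurd (hstrict.1 z hz) hne
      · exact hy' hy

end Explanations

/-! ### The polynomial-time relation -/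

/-- The characteristic word of a set of features. -/
def bits {n : ℕ} (S : Finset (Fin n)) : Word :=
  List.ofFn fun i => decide (i ∈ S)

section Bits

variable {n : ℕ}

@[simp] theorem length_bits (S : Finset (Fin n)) : (bits S).length = n := by
  simp [bits]

theorem exists_bits_eq {w : Word} (h : w.length = n) : ∃ S : Finset (Fin n), bits S = w := by
  subst h
  refine ⟨Finset.univ.filter fun i => w.get i = true, ?_⟩
  simp [bits]

theorem subsetTest_bits (T S : Finset (Fin n)) : subsetTest (bits T) (bits S) = true ↔ T ⊆ S := by
  simp [bits, subsetTest_ofFn, Finset.subset_iff]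

theorem disjointTest_bits (T S : Finset (Fin n)) :
    disjointTest (bits T) (bits S) = true ↔ Disjoint T S := by
  simp [bits, disjointTest_ofFn, Finset.disjoint_left]

theorem bits_inj {T S : Finset (Fin n)} : bits T = bits S ↔ T = S := by
  refine ⟨fun h => ?_, fun h => by rw [h]⟩
  have := List.ofFn_injective h
  ext i
  simpa using congrFun this i

end Bits

namespace ClassifierScheme

variable (𝒮 : ClassifierScheme)

open scoped Classical in
/-- Is a list of words a feature vector in the constrained feature space? -/
noncomputable def feasibleTest (t : Word × List Word) : Bool :=
  decide (∃ z ∈ 𝒮.feasible t.1, 𝒮.values z = t.2)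

open scoped Classical in
/-- The class of a list of words. -/
noncomputable def classOf (t : Word × List Word) : Word :=
  if h : ∃ z ∈ 𝒮.feasible t.1, 𝒮.values z = t.2 then
    𝒮.classify t.1 ⟨h.choose, h.choose_spec.1⟩ else []

variable {𝒮}

theorem values_injective {m : Word} : Function.Injective (𝒮.values (m := m)) := fun y z h => by
  funext i
  exact Subtype.ext (congrFun (List.ofFn_injective h) i)

@[simp] theorem length_values {m : Word} (z : ∀ i, 𝒮.dom m i) :
    (𝒮.values z).length = 𝒮.numFeatures m := by
  simp [values]

theorem feasibleTest_iff {m : Word} {zs : List Word} :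
    𝒮.feasibleTest (m, zs) = true ↔ ∃ z : 𝒮.feasible m, 𝒮.values z.1 = zs := by
  simp [feasibleTest]

theorem classOf_values {m : Word} (z : 𝒮.feasible m) :
    𝒮.classOf (m, 𝒮.values z.1) = 𝒮.classify m z := by
  have h : ∃ y ∈ 𝒮.feasible m, 𝒮.values y = 𝒮.values z.1 := ⟨z.1, z.2, rfl⟩
  rw [classOf, dif_pos h]
  congr 1
  exact Subtype.ext (values_injective h.choose_spec.2)

theorem agreeTest_values {m : Word} (S : Finset (Fin (𝒮.numFeatures m))) (y z : ∀ i, 𝒮.dom m i) :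
    agreeTest (bits S) (𝒮.values y) (𝒮.values z) = true ↔ AgreeOn S y z := by
  simp [bits, values, agreeTest_ofFn, AgreeOn, Subtype.ext_iff]

theorem IsPolyTime.feasibleTest (h : 𝒮.IsPolyTime) : PolyTime 𝒮.feasibleTest :=
  PolyTimeComputable.of_code_eq h.feasible_decidable fun t => ⟨t, rfl, rfl⟩

/-- The classifier may be called on feasible vectors only, so feasibility is decided first. -/
theorem IsPolyTime.classOf (h : 𝒮.IsPolyTime) : PolyTime 𝒮.classOf := by
  refine PolyTime.dite h.feasibleTest (f := fun t => 𝒮.classOf t.1) (g := fun _ => []) ?_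
    (PolyTime.const []) (fun _ _ => rfl) fun t ht => ?_
  · refine PolyTimeComputable.of_code_eq h.classify_computable ?_
    rintro ⟨⟨m, zs⟩, hz⟩
    obtain ⟨z, rfl⟩ := feasibleTest_iff.1 hz
    exact ⟨⟨m, z⟩, rfl, (classOf_values z).symm⟩
  · rw [ClassifierScheme.classOf, dif_neg]
    simpa [ClassifierScheme.feasibleTest] using ht

variable (𝒮)

/-- One instance of the condition that characterizes PI-explanations: `S` and `T` are characteristic
words, `xs`, `ys` and `zs` are lists of feature values. -/
noncomputable def explanationTest (m : Word) (xs : List Word) (S T : Word) (ys zs : List Word) :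
    Bool :=
  (!agreeTest S ys xs || eqWord (𝒮.classOf (m, ys)) (𝒮.classOf (m, xs))) &&
    ((𝒮.feasibleTest (m, zs) &&
        ((agreeTest T zs xs && !eqWord (𝒮.classOf (m, zs)) (𝒮.classOf (m, xs))) ||
          (agreeTest S zs xs && !agreeTest T zs xs))) ||
      ((!agreeTest T ys xs || agreeTest S ys xs) && !(subsetTest T S && !eqWord T S)))

/-- The test for the witnesses `S`, `(T, ys)` and `zs`: the first one has to be a set of features,
and the second one may be anything unless it consists of a set of features and a feature vector. -/
noncomputable def witnessTest (m : Word) (xs : List Word) (S T : Word) (ys zs : List Word) : Bool :=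
  sameLength S xs && (!(sameLength T xs && 𝒮.feasibleTest (m, ys)) ||
    𝒮.explanationTest m xs S T ys zs)

/-- Does the list of words describe an input of the fairness problems? -/
noncomputable def inputTest (ws : List Word) : Bool :=
  !ws.tail.isEmpty && (sameLength (ws.tail.headD []) ws.tail.tail &&
    𝒮.feasibleTest (ws.headD [], ws.tail.tail))

variable {𝒮}

section PolyTime

variable {α : Type} [WordCode α]

theorem IsPolyTime.inputTest (h : 𝒮.IsPolyTime) {ws : α → List Word} (hws : PolyTime ws) :
    PolyTime fun a => 𝒮.inputTest (ws a) := by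
  have ht := PolyTime.tailWords.comp hws
  have htt := PolyTime.tailWords.comp ht
  exact .and (.not (PolyTime.isEmptyWords.comp ht)) (.and (.sameLength (PolyTime.headWord.comp ht)
    htt) (h.feasibleTest.comp (.pair (PolyTime.headWord.comp hws) htt)))

theorem IsPolyTime.witnessTest (h : 𝒮.IsPolyTime) {m S T : α → Word} {xs ys zs : α → List Word}
    (hm : PolyTime m) (hxs : PolyTime xs) (hS : PolyTime S) (hT : PolyTime T) (hys : PolyTime ys)
    (hzs : PolyTime zs) :
    PolyTime fun a => 𝒮.witnessTest (m a) (xs a) (S a) (T a) (ys a) (zs a) := by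
  have hc {vs : α → List Word} (hvs : PolyTime vs) :
      PolyTime fun a => eqWord (𝒮.classOf (m a, vs a)) (𝒮.classOf (m a, xs a)) :=
    .eqWord (h.classOf.comp (.pair hm hvs)) (h.classOf.comp (.pair hm hxs))
  have hf {vs : α → List Word} (hvs : PolyTime vs) :
      PolyTime fun a => 𝒮.feasibleTest (m a, vs a) := h.feasibleTest.comp (.pair hm hvs)
  exact .and (.sameLength hS hxs) <| .or (.not (.and (.sameLength hT hxs) (hf hys))) <|
    .and (.or (.not (.agreeTest hS hys hxs)) (hc hys)) <|
      .or (.and (hf hzs) (.or (.and (.agreeTest hT hzs hxs) (.not (hc hzs)))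
        (.and (.agreeTest hS hzs hxs) (.not (.agreeTest hT hzs hxs)))))
        (.and (.or (.not (.agreeTest hT hys hxs)) (.agreeTest hS hys hxs))
          (.not (.and (.subsetTest hT hS) (.not (.eqWord hT hS)))))

end PolyTime

end ClassifierScheme

end FairDecision

/-! ### Coded inputs, lengths of witnesses, and membership in the two classes -/

namespace FairDecision

/-- A nested pair leaves its last component undelimited, unlike `encodeWords`. The components are
therefore read off as entries of a list. -/
theorem PolyTime.polyTimeDecidable {R : Word × Word × Word × Word → Bool} (hR : PolyTime R) :
    PolyTimeDecidable (fun t => encodeWords [t.1, t.2.1, t.2.2.1, t.2.2.2])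
      (fun t => R t = true) := by
  have h₀ : PolyTime fun ws : List Word => ws := .id
  have h₁ := tailWords.comp h₀
  have h₂ := tailWords.comp h₁
  have h₃ := tailWords.comp h₂
  have h := hR.comp (.pair (headWord.comp h₀) (.pair (headWord.comp h₁)
    (.pair (headWord.comp h₂) (headWord.comp h₃))))
  refine PolyTimeComputable.of_code_eq h fun t => ⟨[t.1, t.2.1, t.2.2.1, t.2.2.2], rfl, ?_⟩
  simp [WordCode.code]

theorem length_encodeWords_le {ws : List Word} {b : ℕ} (h : ∀ w ∈ ws, w.length ≤ b) :
    (encodeWords ws).length ≤ ws.length * (2 * b + 1) := by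
  induction ws with
  | nil => simp
  | cons w ws ih =>
    have h₁ := h w (by simp)
    have h₂ := ih fun v hv => h v (by simp [hv])
    rw [encodeWords_cons, List.length_append, length_delimit, List.length_cons, add_mul]
    omega

theorem length_le_length_encodeWords (ws : List Word) : ws.length ≤ (encodeWords ws).length := by
  induction ws with
  | nil => simp
  | cons w ws ih =>
    rw [encodeWords_cons, List.length_append, length_delimit, List.length_cons]
    omega

namespace ClassifierScheme

variable {𝒮 : ClassifierScheme}

theorem inputTest_iff {w : Word} :
    (isCode w && 𝒮.inputTest (decodeWords w)) = true ↔ ∃ d : 𝒮.Decision, d.encode = w := by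
  rw [Bool.and_eq_true]
  constructor
  · rintro ⟨hw, h⟩
    obtain ⟨ws, rfl⟩ := (isCode_iff w).1 hw
    rw [decodeWords_encodeWords] at h
    match ws, h with
    | [], h => simp [inputTest] at h
    | [_], h => simp [inputTest] at h
    | m :: P :: xs, h =>
      simp only [inputTest, List.tail_cons, List.headD_cons, List.isEmpty_cons, Bool.not_false,
        Bool.true_and, Bool.and_eq_true, sameLength_iff, feasibleTest_iff] at h
      obtain ⟨hP, x, rfl⟩ := h
      obtain ⟨S, rfl⟩ := exists_bits_eq (hP.trans (length_values x.1))
      exact ⟨⟨m, S, x⟩, rfl⟩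
  · rintro ⟨d, rfl⟩
    refine ⟨(isCode_iff _).2 ⟨_, rfl⟩, ?_⟩
    rw [Decision.encode, decodeWords_encodeWords]
    simp only [inputTest, List.tail_cons, List.headD_cons, List.isEmpty_cons, Bool.not_false,
      Bool.true_and, Bool.and_eq_true, sameLength_iff, feasibleTest_iff]
    exact ⟨by simp, d.point, rfl⟩

/-- Needed because the languages ask for some decision with the given code. -/
theorem Decision.encode_injective : Function.Injective (Decision.encode (𝒮 := 𝒮)) := by
  rintro ⟨m, P, x⟩ ⟨m', P', x'⟩ h
  have h := encodeWords_injective h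
  simp only [List.cons.injEq] at h
  obtain ⟨rfl, hP, hx⟩ := h
  obtain rfl : P = P' := bits_inj.1 hP
  obtain rfl : x = x' := Subtype.ext (values_injective hx)
  rfl

theorem explanationTest_iff {m : Word} {x y : 𝒮.feasible m}
    {S T : Finset (Fin (𝒮.numFeatures m))} {zs : List Word} :
    𝒮.explanationTest m (𝒮.values x.1) (bits S) (bits T) (𝒮.values y.1) zs = true ↔
      (AgreeOn S y.1 x.1 → 𝒮.classify m y = 𝒮.classify m x) ∧
      ((∃ z : 𝒮.feasible m, 𝒮.values z.1 = zs ∧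
          ((AgreeOn T z.1 x.1 ∧ 𝒮.classify m z ≠ 𝒮.classify m x) ∨
            (AgreeOn S z.1 x.1 ∧ ¬ AgreeOn T z.1 x.1))) ∨
        ((AgreeOn T y.1 x.1 → AgreeOn S y.1 x.1) ∧ ¬ T ⊂ S)) := by
  have hss : T ⊂ S ↔ T ⊆ S ∧ ¬ T = S := Finset.ssubset_iff_subset_ne
  simp only [explanationTest, Bool.and_eq_true, Bool.or_eq_true, Bool.not_eq_true',
    ← Bool.not_eq_true, agreeTest_values, eqWord_iff, classOf_values, subsetTest_bits,
    bits_inj, hss, ← imp_iff_not_or]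
  refine and_congr_right fun _ => or_congr_left ?_
  constructor
  · rintro ⟨hz, h⟩
    obtain ⟨z, rfl⟩ := feasibleTest_iff.1 hz
    simp only [agreeTest_values, classOf_values] at h
    exact ⟨z, rfl, h⟩
  · rintro ⟨z, rfl, h⟩
    refine ⟨feasibleTest_iff.2 ⟨z, rfl⟩, ?_⟩
    simpa only [agreeTest_values, classOf_values] using h

variable (𝒮) in
/-- The test for an input `w` and witnesses. -/
noncomputable def codeTest (w u₁ u₂ u₃ : Word) : Bool :=
  𝒮.witnessTest ((decodeWords w).headD []) (decodeWords w).tail.tail u₁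
    ((decodeWords u₂).headD []) (decodeWords u₂).tail (decodeWords u₃)

theorem codeTest_encode (d : 𝒮.Decision) (u₁ u₂ u₃ : Word) :
    𝒮.codeTest d.encode u₁ u₂ u₃ = 𝒮.witnessTest d.descr (𝒮.values d.point.1) u₁
      ((decodeWords u₂).headD []) (decodeWords u₂).tail (decodeWords u₃) := by
  rw [codeTest, Decision.encode, decodeWords_encodeWords]
  rfl

/-- A bound for the length of the witnesses. -/
noncomputable def witnessBound (p : Polynomial ℕ) : Polynomial ℕ :=
  -- `2 * .X + 1` covers a delimited characteristic word, and `.X * (2 * p + 1)` covers at most `X`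
  -- delimited values of length at most `p`.
  2 * .X + 1 + .X * (2 * p + 1)

section Bounds

variable {p : Polynomial ℕ} (hp : ∀ m i, ∀ v ∈ 𝒮.dom m i, v.length ≤ p.eval m.length)
  (d : 𝒮.Decision)

theorem numFeatures_le : 𝒮.numFeatures d.descr ≤ d.encode.length := by
  have h := length_le_length_encodeWords (𝒮.values d.point.1)
  rw [length_values] at h
  rw [Decision.encode, encodeWords_cons, encodeWords_cons, List.length_append, List.length_append]
  omega

theorem descr_length_le : d.descr.length ≤ d.encode.length := by
  rw [Decision.encode, encodeWords_cons, List.length_append, length_delimit]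
  omega

include hp in
theorem length_encode_values_le (z : ∀ i, 𝒮.dom d.descr i) :
    (encodeWords (𝒮.values z)).length ≤
      d.encode.length * (2 * p.eval d.encode.length + 1) := by
  refine (length_encodeWords_le (b := p.eval d.encode.length) fun w hw => ?_).trans ?_
  · obtain ⟨i, rfl⟩ := List.mem_ofFn.1 hw
    exact (hp _ i _ (z i).2).trans (eval_mono p (descr_length_le d))
  · rw [length_values]
    exact Nat.mul_le_mul_right _ (numFeatures_le d)

include hp in
-- `u₂` codes `T` followed by the values of `y`, and `u₃` codes `z`. A `u₂` of another shape passes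
-- the test, while an unsuitable `u₃` can only pass through the alternatives that need no `z`; so
-- the word quantifiers match those of `isPIExplanation_iff`.
theorem isPIExplanation_iff_codeTest (S : Finset (Fin (𝒮.numFeatures d.descr))) :
    IsPIExplanation (𝒮.feasible d.descr) (𝒮.classify d.descr) d.point S ↔
      ∀ u₂ : Word, u₂.length ≤ (witnessBound p).eval d.encode.length →
        ∃ u₃ : Word, u₃.length ≤ (witnessBound p).eval d.encode.length ∧
          𝒮.codeTest d.encode (bits S) u₂ u₃ = true := by
  have hb : (witnessBound p).eval d.encode.length = 2 * d.encode.length + 1 +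
      d.encode.length * (2 * p.eval d.encode.length + 1) := by
    simp [witnessBound]
  have hn := numFeatures_le d
  rw [isPIExplanation_iff]
  constructor
  · intro h u₂ _
    by_cases hu : sameLength ((decodeWords u₂).headD []) (𝒮.values d.point.1) = true ∧
        𝒮.feasibleTest (d.descr, (decodeWords u₂).tail) = true
    · obtain ⟨hT, hy⟩ := hu
      rw [sameLength_iff, length_values] at hT
      obtain ⟨T, hT⟩ := exists_bits_eq hT
      obtain ⟨y, hy⟩ := feasibleTest_iff.1 hy
      simp only [codeTest_encode, witnessTest, Bool.and_eq_true, Bool.or_eq_true, ← hT, ← hy,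
        explanationTest_iff, sameLength_iff, length_bits, length_values, true_and]
      obtain ⟨h₁, ⟨z, hz⟩ | h₂⟩ := h T y
      · refine ⟨encodeWords (𝒮.values z.1), ?_, .inr ⟨h₁, .inl ⟨z, ?_, hz⟩⟩⟩
        · have := length_encode_values_le hp d z.1
          omega
        · rw [decodeWords_encodeWords]
      · exact ⟨[], Nat.zero_le _, .inr ⟨h₁, .inr h₂⟩⟩
    · refine ⟨[], Nat.zero_le _, ?_⟩
      rw [← Bool.and_eq_true, Bool.not_eq_true] at hu
      rw [codeTest_encode, witnessTest, hu]
      simp [sameLength_iff]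
  · intro h T y
    obtain ⟨u₃, -, h₃⟩ := h (encodeWords (bits T :: 𝒮.values y.1)) (by
      have := length_encode_values_le hp d y.1
      rw [encodeWords_cons, List.length_append, length_delimit, length_bits]
      omega)
    rw [codeTest_encode, decodeWords_encodeWords] at h₃
    have hy : 𝒮.feasibleTest (d.descr, 𝒮.values y.1) = true := feasibleTest_iff.2 ⟨y, rfl⟩
    have hT : sameLength (bits T) (𝒮.values d.point.1) = true := by simp [sameLength_iff]
    simp only [witnessTest, List.headD_cons, List.tail_cons, hy, hT, Bool.and_self, Bool.not_true,
      Bool.false_or, Bool.and_eq_true, explanationTest_iff] at h₃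
    exact ⟨h₃.2.1, h₃.2.2.imp_left fun ⟨z, _, hz⟩ => ⟨z, hz⟩⟩

include hp in
-- The extra test `g` is "fair" for the one problem and "not fair" for the complement of the other.
theorem exists_isPIExplanation_iff (g : Word → Bool) :
    (∃ S, IsPIExplanation (𝒮.feasible d.descr) (𝒮.classify d.descr) d.point S ∧
      g (bits S) = true) ↔
    ∃ u₁ : Word, u₁.length ≤ (witnessBound p).eval d.encode.length ∧
      ∀ u₂ : Word, u₂.length ≤ (witnessBound p).eval d.encode.length →
        ∃ u₃ : Word, u₃.length ≤ (witnessBound p).eval d.encode.length ∧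
          (g u₁ && 𝒮.codeTest d.encode u₁ u₂ u₃) = true := by
  constructor
  · rintro ⟨S, hS, hg⟩
    refine ⟨bits S, ?_, fun u₂ hu₂ => ?_⟩
    · have := numFeatures_le d
      simp only [witnessBound, length_bits, Polynomial.eval_add, Polynomial.eval_mul,
        Polynomial.eval_X, Polynomial.eval_ofNat, Polynomial.eval_one]
      omega
    · obtain ⟨u₃, hu₃, h⟩ := (isPIExplanation_iff_codeTest hp d S).1 hS u₂ hu₂
      exact ⟨u₃, hu₃, by rw [hg, h]; rfl⟩
  · rintro ⟨u₁, -, h⟩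
    -- The tests on `u₁` alone do not depend on `u₂`, so the empty word suffices to learn that `u₁`
    -- is a characteristic word and satisfies `g`.
    obtain ⟨v, -, hv⟩ := h [] (Nat.zero_le _)
    simp only [codeTest_encode, witnessTest, Bool.and_eq_true, sameLength_iff, length_values] at hv
    obtain ⟨S, rfl⟩ := exists_bits_eq hv.2.1
    refine ⟨S, (isPIExplanation_iff_codeTest hp d S).2 fun u₂ hu₂ => ?_, hv.1⟩
    obtain ⟨u₃, hu₃, h₃⟩ := h u₂ hu₂
    exact ⟨u₃, hu₃, (Bool.and_eq_true _ _ ▸ h₃).2⟩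

end Bounds

theorem mem_existentialFairness {d : 𝒮.Decision} : d.encode ∈ 𝒮.existentialFairness ↔
    ExistentiallyFair (𝒮.feasible d.descr) (𝒮.classify d.descr) d.protectedSet d.point :=
  ⟨fun ⟨_, h, h'⟩ => Decision.encode_injective h ▸ h', fun h => ⟨d, rfl, h⟩⟩

theorem mem_universalFairness {d : 𝒮.Decision} : d.encode ∈ 𝒮.universalFairness ↔
    UniversallyFair (𝒮.feasible d.descr) (𝒮.classify d.descr) d.protectedSet d.point :=
  ⟨fun ⟨_, h, h'⟩ => Decision.encode_injective h ▸ h', fun h => ⟨d, rfl, h⟩⟩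

/-- The characteristic word of the set of protected features in the code of an input. -/
noncomputable def protectedWord (w : Word) : Word :=
  (decodeWords w).tail.headD []

theorem protectedWord_encode (d : 𝒮.Decision) : protectedWord d.encode = bits d.protectedSet := by
  rw [protectedWord, Decision.encode, decodeWords_encodeWords]
  rfl

theorem polyTime_fairTest : PolyTime fun t : Word × Word × Word × Word =>
    disjointTest t.2.1 (protectedWord t.1) :=
  .disjointTest (PolyTime.fst.comp .snd) (PolyTime.headWord.comp (PolyTime.tailWords.comp
    (PolyTime.decodeWords.comp .fst)))

section Tests

variable (h𝒮 : 𝒮.IsPolyTime)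

include h𝒮

theorem IsPolyTime.inputCodeTest : PolyTime fun t : Word × Word × Word × Word =>
    isCode t.1 && 𝒮.inputTest (decodeWords t.1) :=
  .and (PolyTime.isCode.comp .fst) (h𝒮.inputTest (PolyTime.decodeWords.comp .fst))

theorem IsPolyTime.codeTest : PolyTime fun t : Word × Word × Word × Word =>
    𝒮.codeTest t.1 t.2.1 t.2.2.1 t.2.2.2 := by
  have h₁ := PolyTime.decodeWords.comp (.fst (α := Word) (β := Word × Word × Word))
  have h₂ := PolyTime.fst.comp (.snd (α := Word) (β := Word × Word × Word))
  have h := PolyTime.snd.comp (.snd (α := Word) (β := Word × Word × Word))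
  have h₃ := PolyTime.decodeWords.comp (PolyTime.fst.comp h)
  have h₄ := PolyTime.decodeWords.comp (PolyTime.snd.comp h)
  exact h𝒮.witnessTest (PolyTime.headWord.comp h₁)
    (PolyTime.tailWords.comp (PolyTime.tailWords.comp h₁)) h₂ (PolyTime.headWord.comp h₃)
    (PolyTime.tailWords.comp h₃) h₄

theorem inSigma3P_existentialFairness : InSigma3P 𝒮.existentialFairness := by
  obtain ⟨p, hp⟩ := h𝒮.dom_bounded
  refine ⟨witnessBound p, _, (PolyTime.and h𝒮.inputCodeTest
    (.and polyTime_fairTest h𝒮.codeTest)).polyTimeDecidable, fun w => ?_⟩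
  by_cases hw : ∃ d : 𝒮.Decision, d.encode = w
  · have hi := inputTest_iff.2 hw
    obtain ⟨d, rfl⟩ := hw
    simp only [hi, Bool.true_and, protectedWord_encode]
    rw [mem_existentialFairness, ← exists_isPIExplanation_iff hp d fun u =>
      disjointTest u (bits d.protectedSet)]
    simp only [disjointTest_bits]
    rfl
  · have hi := hw
    rw [← inputTest_iff, Bool.not_eq_true] at hi
    simp only [hi, Bool.false_and, Bool.false_eq_true, and_false, exists_false]
    refine iff_of_false (fun ⟨d, hd, _⟩ => hw ⟨d, hd⟩) fun ⟨_, _, h⟩ => h [] (Nat.zero_le _)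

theorem inPi3P_universalFairness : InPi3P 𝒮.universalFairness := by
  obtain ⟨p, hp⟩ := h𝒮.dom_bounded
  -- Words that code no input lie in the complement, so here they must be accepted, whereas the
  -- relation for existential fairness rejects them.
  refine ⟨witnessBound p, _, (PolyTime.or (.not h𝒮.inputCodeTest)
    (.and (.not polyTime_fairTest) h𝒮.codeTest)).polyTimeDecidable, fun w => ?_⟩
  by_cases hw : ∃ d : 𝒮.Decision, d.encode = w
  · have hi := inputTest_iff.2 hw
    obtain ⟨d, rfl⟩ := hw
    simp only [hi, Bool.not_true, Bool.false_or, protectedWord_encode]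
    rw [Set.mem_compl_iff, mem_universalFairness, ← exists_isPIExplanation_iff hp d fun u =>
      !disjointTest u (bits d.protectedSet)]
    simp only [UniversallyFair, not_forall, exists_prop, Bool.not_eq_true', ← Bool.not_eq_true,
      disjointTest_bits]
    rfl
  · have hi := hw
    rw [← inputTest_iff, Bool.not_eq_true] at hi
    simp only [hi, Bool.not_false, Bool.true_or, and_true]
    exact iff_of_true (fun ⟨d, hd, _⟩ => hw ⟨d, hd⟩)
      ⟨[], Nat.zero_le _, fun _ _ => ⟨[], Nat.zero_le _⟩⟩

end Tests

end ClassifierScheme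

end FairDecision

theorem mainTheorem10 (𝒮 : FairDecision.ClassifierScheme) (h𝒮 : 𝒮.IsPolyTime) :
    FairDecision.InSigma3P 𝒮.existentialFairness ∧
      FairDecision.InPi3P 𝒮.universalFairness :=
  ⟨FairDecision.ClassifierScheme.inSigma3P_existentialFairness h𝒮,
    FairDecision.ClassifierScheme.inPi3P_universalFairness h𝒮⟩
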